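/- A \emph{prop} is a strict symmetric monoidal category whose objects are the natural numbers, with tensor product of objects given by addition; a \emph{morphism of props} is a strict symmetric monoidal functor that is the identity on objects. Let $k$ be a field, and consider the following props, described by their morphisms $m \to n$. \begin{itemize} \item $\mathrm{FinCospan}$: isomorphism classes of cospans of finite sets $m \xrightarrow{i} N \xleftarrow{o} n$, composed by pushout, with disjoint union as tensor product. $\mathrm{FinCorel}$: partitions of the disjoint union $m + n$ (equivalently, isomorphism classes of jointly epic cospans), composed as cospans followed by restriction of the apex to the joint image of the legs. $H \colon \mathrm{FinCospan} \to \mathrm{FinCorel}$ is the morphism of props that restricts the apex of a cospan to the joint image of its legs. \item $\mathrm{Circ}_L$, for a set $L$: isomorphism classes of $L$-circuits, that is, cospans of finite sets $m \to N \leftarrow n$ together with a finite set $E$ of edges, source and target maps $s, t \colon E \to N$ and a labelling $\ell \colon E \to L$; composition is by pushout on nodes and disjoint union on edges, and the tensor product is disjoint union. Circuits without edges form a copy of $\mathrm{FinCospan}$, and each $l \in L$ gives a morphism $l \colon 1 \to 1$, a single edge labelled $l$ from the input node to the output node. \item $\mathrm{LagRel}_k$: linear Lagrangian relations from $(k\oplus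 k)^m$ to $(k \oplus k)^n$, that is, maximal isotropic subspaces of $\overline{(k\oplus k)^m} \oplus (k \oplus k)^n$, where $k \oplus k$ has the symplectic structure $\omega((\phi,I),(\phi',I')) = \phi I' - \phi' I$, powers carry the direct sum structure, and the bar changes the sign of the symplectic structure; composition is that of relations and the tensor product is direct sum. \item $K \colon \mathrm{FinCorel} \to \mathrm{LagRel}_k$ is the morphism of props sending a partition of $m+n$ to the set of all families of potentials and currents $(\phi_i, I_i)_{i \in m}$, $(\phi'_j, I'_j)_{j \in n}$ such that the potential is constant on each block and, on each block, the sum of the input currents $I_i$ equals the sum of the output currents $I'_j$. \end{itemize} \textbf{Theorem.} There exists a unique morphism of props $\blacksquare \colon \mathrm{Circ}_k \to \mathrm{LagRel}_k$ such that $\blacksquare|_{\mathrm{FinCospan}} = K \circ H$ and, for each $Z \in k$, \[ \blacksquare(Z) = \{ (\phi_1, I_1, \phi_2, I_2) : \phi_2 - \phi_1 = Z I_1, \; I_1 = I_2 \} \colon k \oplus k \nrightarrow k \oplus k . \] Moreover, $\blacksquare$ extends black-boxing of circuits of ideal wires: let $\mathrm{Circ} = \mathrm{Circ}_{\{\ell\}}$,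 let $H' \colon \mathrm{Circ} \to \mathrm{FinCospan}$ be the morphism of props that replaces the graph of a circuit by its set of connected components, and let $j \colon \mathrm{Circ} \to \mathrm{Circ}_k$ be the morphism of props that changes the label $\ell$ to $0 \in k$. Then $\blacksquare \circ j = K \circ H \circ H'$. -/

import Mathlib

universe u v w

namespace BlackBoxing

/-! ### Props -/

/-- Transport of a morphism `a ⟶ b` along equalities of objects. In a strict monoidal category
this is composition with the identity morphisms `a' = a` and `b = b'`. -/
def homCast {Hom : ℕ → ℕ → Type u} {a a' b b' : ℕ} (ha : a = a') (hb : b = b')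
    (f : Hom a b) : Hom a' b' :=
  ha ▸ hb ▸ f

/-- A prop: a strict symmetric monoidal category whose objects are the natural numbers, the tensor
product of objects being addition. Composition is written in diagrammatic order. The transports
`homCast` express that the associator and the unitors are identities. -/
structure PROP where
  Hom : ℕ → ℕ → Type u
  id : ∀ n, Hom n n
  comp : ∀ {a b c}, Hom a b → Hom b c → Hom a c
  tens : ∀ {a b c d}, Hom a b → Hom c d → Hom (a + c) (b + d)
  braid : ∀ a b, Hom (a + b) (b + a)
  id_comp : ∀ {a b} (f : Hom a b), comp (id a) f = f
  comp_id : ∀ {a b} (f : Hom a b), comp f (id b) = f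
  comp_assoc : ∀ {a b c d} (f : Hom a b) (g : Hom b c) (h : Hom c d),
    comp (comp f g) h = comp f (comp g h)
  tens_id : ∀ a b, tens (id a) (id b) = id (a + b)
  tens_comp : ∀ {a b c a' b' c'} (f : Hom a b) (g : Hom b c) (f' : Hom a' b') (g' : Hom b' c'),
    tens (comp f g) (comp f' g') = comp (tens f f') (tens g g')
  tens_assoc : ∀ {a b c d a' b'} (f : Hom a b) (g : Hom c d) (h : Hom a' b'),
    homCast (Nat.add_assoc a c a') (Nat.add_assoc b d b') (tens (tens f g) h)
      = tens f (tens g h)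
  id_tens : ∀ {a b} (f : Hom a b), homCast (Nat.zero_add a) (Nat.zero_add b) (tens (id 0) f) = f
  tens_id_zero : ∀ {a b} (f : Hom a b),
    homCast (Nat.add_zero a) (Nat.add_zero b) (tens f (id 0)) = f
  braid_natural : ∀ {a b c d} (f : Hom a b) (g : Hom c d),
    comp (tens f g) (braid b d) = comp (braid a c) (tens g f)
  /-- The hexagon identity; by `braid_symm` it implies the other one. -/
  hexagon : ∀ a b c,
    homCast (Nat.add_assoc a b c).symm rfl (braid a (b + c))
      = comp (tens (braid a b) (id c))
          (homCast (Nat.add_assoc b a c).symm (Nat.add_assoc b c a).symm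
            (tens (id b) (braid a c)))
  braid_symm : ∀ a b, comp (braid a b) (braid b a) = id (a + b)

/-- A morphism of props: a strict symmetric monoidal functor that is the identity on objects. -/
@[ext]
structure PROP.Mor (P : PROP.{u}) (Q : PROP.{v}) where
  map : ∀ {a b}, P.Hom a b → Q.Hom a b
  map_id : ∀ a, map (P.id a) = Q.id a
  map_comp : ∀ {a b c} (f : P.Hom a b) (g : P.Hom b c),
    map (P.comp f g) = Q.comp (map f) (map g)
  map_tens : ∀ {a b c d} (f : P.Hom a b) (g : P.Hom c d),
    map (P.tens f g) = Q.tens (map f) (map g)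
  map_braid : ∀ a b, map (P.braid a b) = Q.braid a b

/-- Composition of morphisms of props, first `F`, then `G`. -/
def PROP.Mor.trans {P : PROP.{u}} {Q : PROP.{v}} {R : PROP.{w}} (F : PROP.Mor P Q)
    (G : PROP.Mor Q R) : PROP.Mor P R where
  map f := G.map (F.map f)
  map_id a := by rw [F.map_id, G.map_id]
  map_comp f g := by rw [F.map_comp, G.map_comp]
  map_tens f g := by rw [F.map_tens, G.map_tens]
  map_braid a b := by rw [F.map_braid, G.map_braid]

/-! ### Maps between finite ordinals -/

/-- The map `a + b → A ⊔ B` that is `f` on the first `a` elements and `g` on the last `b`. -/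
def split {a b : ℕ} {A B : Type} (f : Fin a → A) (g : Fin b → B) : Fin (a + b) → A ⊕ B :=
  Fin.addCases (fun x => Sum.inl (f x)) (fun x => Sum.inr (g x))

@[simp] theorem split_castAdd {a b : ℕ} {A B : Type} (f : Fin a → A) (g : Fin b → B) (x : Fin a) :
    split f g (Fin.castAdd b x) = Sum.inl (f x) := by simp [split]

@[simp] theorem split_natAdd {a b : ℕ} {A B : Type} (f : Fin a → A) (g : Fin b → B) (x : Fin b) :
    split f g (Fin.natAdd a x) = Sum.inr (g x) := by simp [split]

theorem sum_map_split {a b : ℕ} {A B A' B' : Type} (f : Fin a → A) (g : Fin b → B) (e : A → A')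
    (e' : B → B') (x) : Sum.map e e' (split f g x) = split (fun x => e (f x)) (fun x => e' (g x)) x := by
  refine Fin.addCases (fun x => ?_) (fun x => ?_) x <;> simp

theorem sumAssoc_split {a b c : ℕ} {A B C : Type} (f : Fin a → A) (g : Fin b → B) (h : Fin c → C)
    (x : Fin (a + (b + c))) :
    Equiv.sumAssoc A B C (split (split f g) h (Fin.cast (Nat.add_assoc a b c).symm x))
      = split f (split g h) x := by
  refine Fin.addCases (fun x => ?_) (fun x => ?_) x
  · have h1 : Fin.cast (Nat.add_assoc a b c).symm (Fin.castAdd (b + c) x)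
      = Fin.castAdd c (Fin.castAdd b x) := rfl
    simp [h1]
  · refine Fin.addCases (fun x => ?_) (fun x => ?_) x
    · have h1 : Fin.cast (Nat.add_assoc a b c).symm (Fin.natAdd a (Fin.castAdd c x))
        = Fin.castAdd c (Fin.natAdd a x) := rfl
      simp [h1]
    · have h1 : Fin.cast (Nat.add_assoc a b c).symm (Fin.natAdd a (Fin.natAdd b x))
        = Fin.natAdd (a + b) x := by ext; simp [Nat.add_assoc]
      simp only [h1, split_natAdd]; simp

theorem emptySum_split {a : ℕ} {A B : Type} [IsEmpty A] (f : Fin 0 → A) (g : Fin a → B) (x : Fin a) :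
    Equiv.emptySum A B (split f g (Fin.cast (Nat.zero_add a).symm x)) = g x := by
  have h1 : Fin.cast (Nat.zero_add a).symm x = Fin.natAdd 0 x := by ext; simp
  rw [h1, split_natAdd]; rfl

theorem sumEmpty_split {a : ℕ} {A B : Type} [IsEmpty B] (f : Fin a → A) (g : Fin 0 → B) (x : Fin a) :
    Equiv.sumEmpty A B (split f g (Fin.cast (Nat.add_zero a).symm x)) = f x := by
  have h1 : Fin.cast (Nat.add_zero a).symm x = Fin.castAdd 0 x := rfl
  rw [h1, split_castAdd]; rfl

theorem sumComm_split {a b : ℕ} {A B : Type} (f : Fin a → A) (g : Fin b → B) (x) :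
    Equiv.sumComm A B (split f g x) = split g f (finAddFlip x) := by
  refine Fin.addCases (fun x => ?_) (fun x => ?_) x <;> simp

/-- Two maps of finite ordinals, side by side. -/
def finSum {a b c d : ℕ} (f : Fin a → Fin b) (g : Fin c → Fin d) : Fin (a + c) → Fin (b + d) :=
  Fin.addCases (fun x => Fin.castAdd d (f x)) (fun x => Fin.natAdd b (g x))

@[simp] theorem finSum_castAdd {a b c d : ℕ} (f : Fin a → Fin b) (g : Fin c → Fin d) (x : Fin a) :
    finSum f g (Fin.castAdd c x) = Fin.castAdd d (f x) := by simp [finSum]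

@[simp] theorem finSum_natAdd {a b c d : ℕ} (f : Fin a → Fin b) (g : Fin c → Fin d) (x : Fin c) :
    finSum f g (Fin.natAdd a x) = Fin.natAdd b (g x) := by simp [finSum]

theorem finSumFinEquiv_split {a b c d : ℕ} (f : Fin a → Fin b) (g : Fin c → Fin d) (x) :
    finSumFinEquiv (split f g x) = finSum f g x := by
  refine Fin.addCases (fun x => ?_) (fun x => ?_) x <;> simp

theorem finSum_id (a b : ℕ) : finSum (id : Fin a → Fin a) (id : Fin b → Fin b) = id := by
  funext x
  refine Fin.addCases (fun x => ?_) (fun x => ?_) x <;> simp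

theorem flip_flip (a b : ℕ) :
    (finAddFlip : Fin (b + a) ≃ Fin (a + b)) ∘ (finAddFlip : Fin (a + b) ≃ Fin (b + a)) = id := by
  funext x
  refine Fin.addCases (fun x => ?_) (fun x => ?_) x <;> simp

theorem flip_hexagon (a b c : ℕ) :
    (finAddFlip : Fin (a + (b + c)) ≃ Fin (b + c + a)) ∘ Fin.cast (Nat.add_assoc a b c)
      = (Fin.cast (Nat.add_assoc b c a).symm ∘
          finSum (id : Fin b → Fin b) (finAddFlip : Fin (a + c) ≃ Fin (c + a)) ∘
          Fin.cast (Nat.add_assoc b a c)) ∘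
        finSum (finAddFlip : Fin (a + b) ≃ Fin (b + a)) (id : Fin c → Fin c) := by
  funext x
  refine Fin.addCases (fun x => ?_) (fun x => ?_) x
  · refine Fin.addCases (fun x => ?_) (fun x => ?_) x
    · have h1 : Fin.cast (Nat.add_assoc a b c) (Fin.castAdd c (Fin.castAdd b x))
          = Fin.castAdd (b + c) x := rfl
      have h2 : Fin.cast (Nat.add_assoc b a c) (Fin.castAdd c (Fin.natAdd b x))
          = Fin.natAdd b (Fin.castAdd c x) := rfl
      simp only [Function.comp_apply, h1, finSum_castAdd, finAddFlip_apply_castAdd, h2,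
        finSum_natAdd]
      ext; simp [Nat.add_assoc]
    · have h1 : Fin.cast (Nat.add_assoc a b c) (Fin.castAdd c (Fin.natAdd a x))
          = Fin.natAdd a (Fin.castAdd c x) := rfl
      have h2 : Fin.cast (Nat.add_assoc b a c) (Fin.castAdd c (Fin.castAdd a x))
          = Fin.castAdd (a + c) x := rfl
      simp only [Function.comp_apply, h1, finSum_castAdd, finAddFlip_apply_natAdd, h2, id]
      ext; simp
  · have h1 : Fin.cast (Nat.add_assoc a b c) (Fin.natAdd (a + b) x)
        = Fin.natAdd a (Fin.natAdd b x) := by ext; simp [Nat.add_assoc]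
    have h2 : Fin.cast (Nat.add_assoc b a c) (Fin.natAdd (b + a) x)
        = Fin.natAdd b (Fin.natAdd a x) := by ext; simp [Nat.add_assoc]
    simp only [Function.comp_apply, h1, finSum_natAdd, finAddFlip_apply_natAdd, h2, id]
    ext; simp

/-! ### Pushouts of finite sets -/

/-- The pushout `A +_Y B` of `f : Y → A` and `g : Y → B`. -/
def Pushout {Y A B : Type} (f : Y → A) (g : Y → B) : Type :=
  Quot (fun p q : A ⊕ B => ∃ y, p = Sum.inl (f y) ∧ q = Sum.inr (g y))

namespace Pushout

variable {Y A B : Type} {f : Y → A} {g : Y → B}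

/-- The first coprojection into the pushout. -/
def inl (f : Y → A) (g : Y → B) (x : A) : Pushout f g := Quot.mk _ (Sum.inl x)

/-- The second coprojection into the pushout. -/
def inr (f : Y → A) (g : Y → B) (x : B) : Pushout f g := Quot.mk _ (Sum.inr x)

theorem glue (y : Y) : inl f g (f y) = inr f g (g y) := Quot.sound ⟨y, rfl, rfl⟩

/-- The universal property of the pushout. -/
def desc {W : Type*} (h : A → W) (h' : B → W) (H : ∀ y, h (f y) = h' (g y)) : Pushout f g → W :=
  Quot.lift (Sum.elim h h') (by rintro _ _ ⟨y, rfl, rfl⟩; exact H y)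

theorem ind {P : Pushout f g → Prop} (h : ∀ x, P (inl f g x)) (h' : ∀ x, P (inr f g x)) (p) :
    P p := by
  rcases p with ⟨x | x⟩
  exacts [h x, h' x]

instance [Finite A] [Finite B] : Finite (Pushout f g) :=
  inferInstanceAs (Finite (Quot _))

/-- Isomorphic diagrams have isomorphic pushouts. -/
def congr {A' B' : Type} {f' : Y → A'} {g' : Y → B'} (e : A ≃ A') (e' : B ≃ B')
    (h : ∀ y, e (f y) = f' y) (h' : ∀ y, e' (g y) = g' y) : Pushout f g ≃ Pushout f' g' where
  toFun := desc (fun x => inl _ _ (e x)) (fun x => inr _ _ (e' x))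
    (fun y => by rw [h, h', glue])
  invFun := desc (fun x => inl _ _ (e.symm x)) (fun x => inr _ _ (e'.symm x))
    (fun y => by rw [← h, ← h', e.symm_apply_apply, e'.symm_apply_apply, glue])
  left_inv := by
    refine ind (fun x => ?_) (fun x => ?_)
    · exact congrArg (inl f g) (e.symm_apply_apply x)
    · exact congrArg (inr f g) (e'.symm_apply_apply x)
  right_inv := by
    refine ind (fun x => ?_) (fun x => ?_)
    · exact congrArg (inl f' g') (e.apply_symm_apply x)
    · exact congrArg (inr f' g') (e'.apply_symm_apply x)

/-- Pushout along an identity. -/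
def idLeft (g : Y → B) : Pushout (id : Y → Y) g ≃ B where
  toFun := desc g id (fun _ => rfl)
  invFun := inr _ _
  left_inv := ind (fun x => (glue (f := (id : Y → Y)) x).symm) (fun _ => rfl)
  right_inv _ := rfl

/-- Pushout along a bijection. -/
def equivRight (f : Y → A) (e : Y ≃ B) : Pushout f e ≃ A where
  toFun := desc id (fun b => f (e.symm b)) (fun y => by simp)
  invFun := inl _ _
  left_inv := ind (fun _ => rfl) (fun x => by
    have := glue (f := f) (g := e) (e.symm x)
    rw [e.apply_symm_apply] at this
    exact this)
  right_inv _ := rfl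

/-- Iterated pushouts are associative. -/
def assoc {Z C : Type} (f : Y → A) (g : Y → B) (f' : Z → B) (g' : Z → C) :
    Pushout (fun z => inr f g (f' z)) g' ≃ Pushout f (fun y => inl f' g' (g y)) where
  toFun := desc
    (desc (fun x => inl _ _ x) (fun x => inr _ _ (inl _ _ x)) (fun y => glue y))
    (fun x => inr _ _ (inr _ _ x))
    (fun z => congrArg (inr _ _) (glue (f := f') (g := g') z))
  invFun := desc
    (fun x => inl _ _ (inl _ _ x))
    (desc (fun x => inl _ _ (inr _ _ x)) (fun x => inr _ _ x) (fun z => glue z))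
    (fun y => congrArg (inl _ _) (glue (f := f) (g := g) y))
  left_inv := ind (ind (fun _ => rfl) (fun _ => rfl)) (fun _ => rfl)
  right_inv := ind (fun _ => rfl) (ind (fun _ => rfl) (fun _ => rfl))

/-- The pushout of a disjoint union of diagrams. -/
def sum {b b' : ℕ} {A B A' B' : Type} (f : Fin b → A) (g : Fin b → B) (f' : Fin b' → A')
    (g' : Fin b' → B') :
    Pushout f g ⊕ Pushout f' g' ≃ Pushout (split f f') (split g g') where
  toFun := Sum.elim
    (desc (fun x => inl _ _ (Sum.inl x)) (fun x => inr _ _ (Sum.inl x)) (fun y => by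
      simpa using glue (f := split f f') (g := split g g') (Fin.castAdd b' y)))
    (desc (fun x => inl _ _ (Sum.inr x)) (fun x => inr _ _ (Sum.inr x)) (fun y => by
      simpa using glue (f := split f f') (g := split g g') (Fin.natAdd b y)))
  invFun := desc (Sum.map (inl _ _) (inl _ _)) (Sum.map (inr _ _) (inr _ _)) (fun y => by
    refine Fin.addCases (fun x => ?_) (fun x => ?_) y <;> simp [glue])
  left_inv := by
    rintro (x | x)
    · revert x; exact ind (fun _ => rfl) (fun _ => rfl)
    · revert x; exact ind (fun _ => rfl) (fun _ => rfl)
  right_inv := by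
    refine ind ?_ ?_ <;> rintro (x | x) <;> rfl

/-- A map of diagrams that is injective on the two vertices and the identity on `Y` induces an
injective map of pushouts. -/
theorem map_injective {A' B' : Type} {f' : Y → A'} {g' : Y → B'} (j : A → A') (j' : B → B')
    (hj : Function.Injective j) (hj' : Function.Injective j')
    (h : ∀ y, j (f y) = f' y) (h' : ∀ y, j' (g y) = g' y) :
    Function.Injective (desc (f := f) (g := g) (fun x => inl f' g' (j x))
      (fun x => inr f' g' (j' x)) (fun y => by rw [h, h', glue])) := by
  classical
  let r : Pushout f' g' → Option (Pushout f g) := desc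
    (fun x => (Function.partialInv j x).map (inl f g))
    (fun x => (Function.partialInv j' x).map (inr f g))
    (fun y => by
      rw [← h, ← h', Function.partialInv_left hj, Function.partialInv_left hj']
      simp [glue])
  have hr : ∀ p, r (desc (f := f) (g := g) (fun x => inl f' g' (j x))
      (fun x => inr f' g' (j' x)) (fun y => by rw [h, h', glue]) p) = some p := by
    refine ind (fun x => ?_) (fun x => ?_)
    · change (Function.partialInv j (j x)).map (inl f g) = _
      rw [Function.partialInv_left hj]; rfl
    · change (Function.partialInv j' (j' x)).map (inr f g) = _
      rw [Function.partialInv_left hj']; rfl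
  intro p q hpq
  have := congrArg r hpq
  rw [hr, hr] at this
  exact Option.some.inj this

end Pushout

/-! ### The prop of cospans of finite sets -/

/-- A cospan of finite sets `m → N ← n`. -/
structure Cospan (m n : ℕ) where
  N : Type
  [fin : Finite N]
  i : Fin m → N
  o : Fin n → N

attribute [instance] Cospan.fin

namespace Cospan

/-- Isomorphism of cospans. -/
instance isoSetoid (m n : ℕ) : Setoid (Cospan m n) where
  r f g := ∃ e : f.N ≃ g.N, (∀ x, e (f.i x) = g.i x) ∧ ∀ y, e (f.o y) = g.o y
  iseqv :=
    { refl := fun f => ⟨Equiv.refl _, fun _ => rfl, fun _ => rfl⟩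
      symm := by
        rintro f g ⟨e, h, h'⟩
        exact ⟨e.symm, fun x => by rw [← h, e.symm_apply_apply],
          fun x => by rw [← h', e.symm_apply_apply]⟩
      trans := by
        rintro f g k ⟨e, h, h'⟩ ⟨e₂, h₂, h₂'⟩
        exact ⟨e.trans e₂, fun x => by simp [h, h₂], fun x => by simp [h', h₂']⟩ }

/-- Composition of cospans by pushout. -/
def comp {a b c : ℕ} (f : Cospan a b) (g : Cospan b c) : Cospan a c where
  N := Pushout f.o g.i
  i x := Pushout.inl _ _ (f.i x)
  o z := Pushout.inr _ _ (g.o z)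

/-- Disjoint union of cospans. -/
def tens {a b c d : ℕ} (f : Cospan a b) (g : Cospan c d) : Cospan (a + c) (b + d) where
  N := f.N ⊕ g.N
  i := split f.i g.i
  o := split f.o g.o

/-- The cospan `m → n ← n` given by a function and an identity. -/
def ofFun {m n : ℕ} (φ : Fin m → Fin n) : Cospan m n where
  N := Fin n
  i := φ
  o := id

theorem comp_congr {a b c : ℕ} {f f' : Cospan a b} {g g' : Cospan b c} (hf : f ≈ f')
    (hg : g ≈ g') : f.comp g ≈ f'.comp g' := by
  obtain ⟨e, h, h'⟩ := hf
  obtain ⟨e₂, h₂, h₂'⟩ := hg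
  exact ⟨Pushout.congr e e₂ h' h₂, fun x => congrArg (Pushout.inl _ _) (h x),
    fun x => congrArg (Pushout.inr _ _) (h₂' x)⟩

theorem tens_congr {a b c d : ℕ} {f f' : Cospan a b} {g g' : Cospan c d} (hf : f ≈ f')
    (hg : g ≈ g') : f.tens g ≈ f'.tens g' := by
  obtain ⟨e, h, h'⟩ := hf
  obtain ⟨e₂, h₂, h₂'⟩ := hg
  exact ⟨Equiv.sumCongr e e₂,
    fun x => (sum_map_split _ _ _ _ x).trans (by simp only [h, h₂]; rfl),
    fun x => (sum_map_split _ _ _ _ x).trans (by simp only [h', h₂']; rfl)⟩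

/-- Transport of a cospan along equalities of objects. -/
def reindex {a a' b b' : ℕ} (ha : a = a') (hb : b = b') (f : Cospan a b) : Cospan a' b' where
  N := f.N
  i x := f.i (Fin.cast ha.symm x)
  o x := f.o (Fin.cast hb.symm x)

end Cospan

/-- Morphisms `m ⟶ n` of `FinCospan`: isomorphism classes of cospans of finite sets. -/
def CospanHom (m n : ℕ) : Type 1 := Quotient (Cospan.isoSetoid m n)

namespace CospanHom

def mk {m n : ℕ} (f : Cospan m n) : CospanHom m n := Quotient.mk _ f

theorem ind {m n : ℕ} {P : CospanHom m n → Prop} (h : ∀ f, P (mk f)) (f) : P f :=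
  Quotient.ind h f

def id (n : ℕ) : CospanHom n n := mk (Cospan.ofFun _root_.id)

def comp {a b c : ℕ} : CospanHom a b → CospanHom b c → CospanHom a c :=
  Quotient.map₂ Cospan.comp (fun _ _ h _ _ h' => Cospan.comp_congr h h')

def tens {a b c d : ℕ} : CospanHom a b → CospanHom c d → CospanHom (a + c) (b + d) :=
  Quotient.map₂ Cospan.tens (fun _ _ h _ _ h' => Cospan.tens_congr h h')

def ofFun {m n : ℕ} (φ : Fin m → Fin n) : CospanHom m n := mk (Cospan.ofFun φ)

theorem mk_eq {m n : ℕ} {f g : Cospan m n} (e : f.N ≃ g.N) (h : ∀ x, e (f.i x) = g.i x)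
    (h' : ∀ x, e (f.o x) = g.o x) : mk f = mk g := Quotient.sound ⟨e, h, h'⟩

theorem comp_mk {a b c : ℕ} (f : Cospan a b) (g : Cospan b c) :
    comp (mk f) (mk g) = mk (f.comp g) := rfl

theorem tens_mk {a b c d : ℕ} (f : Cospan a b) (g : Cospan c d) :
    tens (mk f) (mk g) = mk (f.tens g) := rfl

theorem homCast_mk {a a' b b' : ℕ} (ha : a = a') (hb : b = b') (f : Cospan a b) :
    homCast ha hb (mk f) = mk (f.reindex ha hb) := by
  subst ha hb; rfl

theorem ofFun_comp {a b c : ℕ} (φ : Fin a → Fin b) (g : Cospan b c) :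
    comp (ofFun φ) (mk g) = mk { g with i := fun x => g.i (φ x) } :=
  mk_eq (Pushout.idLeft g.i) (fun _ => rfl) (fun _ => rfl)

theorem comp_ofFun {a b c : ℕ} (f : Cospan a b) (e : Fin b ≃ Fin c) :
    comp (mk f) (ofFun e) = mk { f with o := fun x => f.o (e.symm x) } :=
  mk_eq (Pushout.equivRight f.o e) (fun _ => rfl) (fun _ => rfl)

theorem ofFun_comp_ofFun {a b c : ℕ} (φ : Fin a → Fin b) (ψ : Fin b → Fin c) :
    comp (ofFun φ) (ofFun ψ) = ofFun (ψ ∘ φ) := ofFun_comp φ _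

theorem ofFun_tens_ofFun {a b c d : ℕ} (φ : Fin a → Fin b) (ψ : Fin c → Fin d) :
    tens (ofFun φ) (ofFun ψ) = ofFun (finSum φ ψ) := by
  refine mk_eq finSumFinEquiv (fun x => finSumFinEquiv_split _ _ x) (fun x => ?_)
  exact (finSumFinEquiv_split _ _ x).trans (congrFun (finSum_id b d) x)

theorem homCast_ofFun {a a' b b' : ℕ} (ha : a = a') (hb : b = b') (φ : Fin a → Fin b) :
    homCast ha hb (ofFun φ) = ofFun (Fin.cast hb ∘ φ ∘ Fin.cast ha.symm) := by
  subst ha hb; rfl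

end CospanHom

open CospanHom in
/-- The prop of cospans of finite sets. -/
def FinCospan : PROP.{1} where
  Hom := CospanHom
  id := CospanHom.id
  comp := comp
  tens := tens
  braid a b := ofFun finAddFlip
  id_comp f := by
    induction f using CospanHom.ind with | _ f => exact ofFun_comp _ f
  comp_id f := by
    induction f using CospanHom.ind with | _ f => exact comp_ofFun f (Equiv.refl _)
  comp_assoc f g h := by
    induction f using CospanHom.ind with | _ f =>
    induction g using CospanHom.ind with | _ g =>
    induction h using CospanHom.ind with | _ h =>
    exact mk_eq (Pushout.assoc f.o g.i g.o h.i) (fun _ => rfl) (fun _ => rfl)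
  tens_id a b := by
    simp only [CospanHom.id]
    exact (ofFun_tens_ofFun _ _).trans (by rw [finSum_id]; rfl)
  tens_comp f g f' g' := by
    induction f using CospanHom.ind with | _ f =>
    induction g using CospanHom.ind with | _ g =>
    induction f' using CospanHom.ind with | _ f' =>
    induction g' using CospanHom.ind with | _ g' =>
    refine mk_eq (Pushout.sum f.o g.i f'.o g'.i) (fun x => ?_) (fun x => ?_) <;>
      refine Fin.addCases (fun x => ?_) (fun x => ?_) x <;>
      simp [Cospan.tens, Cospan.comp] <;> rfl
  tens_assoc {a b c d a' b'} f g h := by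
    induction f using CospanHom.ind with | _ f =>
    induction g using CospanHom.ind with | _ g =>
    induction h using CospanHom.ind with | _ h =>
    simp only [tens_mk, homCast_mk]
    exact mk_eq (Equiv.sumAssoc _ _ _) (fun x => sumAssoc_split _ _ _ x)
      (fun x => sumAssoc_split _ _ _ x)
  id_tens {a b} f := by
    induction f using CospanHom.ind with | _ f =>
    simp only [CospanHom.id, tens_mk, homCast_mk]
    exact mk_eq (Equiv.emptySum (Fin 0) f.N) (fun x => emptySum_split (_root_.id : Fin 0 → Fin 0) _ x)
      (fun x => emptySum_split (_root_.id : Fin 0 → Fin 0) _ x)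
  tens_id_zero {a b} f := by
    induction f using CospanHom.ind with | _ f =>
    simp only [CospanHom.id, tens_mk, homCast_mk]
    exact mk_eq (Equiv.sumEmpty f.N (Fin 0)) (fun x => sumEmpty_split _ (_root_.id : Fin 0 → Fin 0) x)
      (fun x => sumEmpty_split _ (_root_.id : Fin 0 → Fin 0) x)
  braid_natural f g := by
    induction f using CospanHom.ind with | _ f =>
    induction g using CospanHom.ind with | _ g =>
    rw [tens_mk, tens_mk, comp_ofFun, ofFun_comp]
    refine mk_eq (Equiv.sumComm _ _) (fun x => sumComm_split _ _ x) (fun x => ?_)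
    refine (sumComm_split _ _ _).trans ?_
    exact congrArg (split g.o f.o) (congrFun (flip_flip _ _) x)
  hexagon a b c := by
    simp only [CospanHom.id]
    rw [homCast_ofFun]
    change _ = comp (tens (ofFun _) (ofFun _)) (homCast _ _ (tens (ofFun _) (ofFun _)))
    rw [ofFun_tens_ofFun, ofFun_tens_ofFun, homCast_ofFun, ofFun_comp_ofFun, ← flip_hexagon]
    rfl
  braid_symm a b := by
    rw [ofFun_comp_ofFun, flip_flip]; rfl

/-! ### The prop of corelations -/

/-- A corelation from `m` to `n`: an equivalence relation on (that is, a partition of) the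
disjoint union `m ⊔ n`. -/
def Corel (m n : ℕ) : Type := Setoid (Fin m ⊕ Fin n)

/-- `R.Rel s t` means that `s` and `t` lie in the same block of the corelation `R`. -/
def Corel.Rel {m n : ℕ} (R : Corel m n) (s t : Fin m ⊕ Fin n) : Prop := Setoid.r (self := R) s t

/-- The corelation given by the jointly epic part of a cospan: two elements of `m ⊔ n` are
equivalent when they have the same image in the apex. -/
def Cospan.toCorel {m n : ℕ} (f : Cospan m n) : Corel m n := Setoid.ker (Sum.elim f.i f.o)

/-- A corelation, seen as a jointly epic cospan with the set of blocks as apex. -/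
def Corel.toCospan {m n : ℕ} (R : Corel m n) : Cospan m n where
  N := Quotient R
  fin := Finite.of_surjective (Quotient.mk R) Quotient.exists_rep
  i x := Quotient.mk R (Sum.inl x)
  o y := Quotient.mk R (Sum.inr y)

namespace Corel

theorem toCorel_toCospan {m n : ℕ} (R : Corel m n) : R.toCospan.toCorel = R := by
  have h : Sum.elim R.toCospan.i R.toCospan.o = Quotient.mk R := by
    funext x; rcases x with x | x <;> rfl
  unfold Cospan.toCorel
  rw [h]
  exact Setoid.ker_mk_eq R

theorem toCorel_eq_of_injective {m n : ℕ} {f g : Cospan m n} (j : f.N → g.N)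
    (hj : Function.Injective j) (h : ∀ x, j (f.i x) = g.i x) (h' : ∀ y, j (f.o y) = g.o y) :
    f.toCorel = g.toCorel := by
  have : Sum.elim g.i g.o = j ∘ Sum.elim f.i f.o := by
    funext x; rcases x with x | x <;> simp [h, h']
  refine Setoid.ext fun x y => ?_
  change Sum.elim f.i f.o x = Sum.elim f.i f.o y ↔ Sum.elim g.i g.o x = Sum.elim g.i g.o y
  rw [this]
  exact hj.eq_iff.symm

/-- The inclusion of the joint image of a cospan into its apex. -/
def incl {m n : ℕ} (f : Cospan m n) : f.toCorel.toCospan.N → f.N :=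
  Setoid.kerLift (Sum.elim f.i f.o)

theorem incl_injective {m n : ℕ} (f : Cospan m n) : Function.Injective (incl f) :=
  Setoid.kerLift_injective _

theorem toCorel_comp {a b c : ℕ} (f : Cospan a b) (g : Cospan b c) :
    (f.toCorel.toCospan.comp g.toCorel.toCospan).toCorel = (f.comp g).toCorel :=
  toCorel_eq_of_injective _
    (Pushout.map_injective (incl f) (incl g) (incl_injective f) (incl_injective g)
      (fun _ => rfl) (fun _ => rfl)) (fun _ => rfl) (fun _ => rfl)

theorem toCorel_tens {a b c d : ℕ} (f : Cospan a b) (g : Cospan c d) :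
    (f.toCorel.toCospan.tens g.toCorel.toCospan).toCorel = (f.tens g).toCorel :=
  toCorel_eq_of_injective (Sum.map (incl f) (incl g))
    (Sum.map_injective.2 ⟨incl_injective f, incl_injective g⟩)
    (fun x => sum_map_split _ _ _ _ x) (fun x => sum_map_split _ _ _ _ x)

/-- The identity corelation. -/
def id (n : ℕ) : Corel n n := (Cospan.ofFun _root_.id).toCorel

/-- Composition of corelations: compose as cospans, then restrict to the joint image. -/
def comp {a b c : ℕ} (R : Corel a b) (S : Corel b c) : Corel a c :=
  (R.toCospan.comp S.toCospan).toCorel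

/-- Disjoint union of corelations. -/
def tens {a b c d : ℕ} (R : Corel a b) (S : Corel c d) : Corel (a + c) (b + d) :=
  (R.toCospan.tens S.toCospan).toCorel

/-- The corelation of a morphism of `FinCospan`. -/
def ofCospanHom {m n : ℕ} : CospanHom m n → Corel m n :=
  Quotient.lift Cospan.toCorel (by
    rintro f g ⟨e, h, h'⟩
    exact toCorel_eq_of_injective e e.injective h h')

theorem ofCospanHom_surjective {m n : ℕ} (R : Corel m n) : ∃ f, ofCospanHom f = R :=
  ⟨CospanHom.mk R.toCospan, R.toCorel_toCospan⟩

theorem ofCospanHom_comp {a b c : ℕ} (f : CospanHom a b) (g : CospanHom b c) :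
    ofCospanHom (CospanHom.comp f g) = comp (ofCospanHom f) (ofCospanHom g) := by
  induction f using CospanHom.ind with | _ f =>
  induction g using CospanHom.ind with | _ g =>
  exact (toCorel_comp f g).symm

theorem ofCospanHom_tens {a b c d : ℕ} (f : CospanHom a b) (g : CospanHom c d) :
    ofCospanHom (CospanHom.tens f g) = tens (ofCospanHom f) (ofCospanHom g) := by
  induction f using CospanHom.ind with | _ f =>
  induction g using CospanHom.ind with | _ g =>
  exact (toCorel_tens f g).symm

theorem ofCospanHom_homCast {a a' b b' : ℕ} (ha : a = a') (hb : b = b') (f : CospanHom a b) :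
    ofCospanHom (homCast ha hb f) = homCast ha hb (ofCospanHom f) := by
  subst ha hb; rfl

end Corel

open Corel in
/-- The prop of corelations. -/
def FinCorel : PROP.{0} where
  Hom := Corel
  id := Corel.id
  comp := comp
  tens := tens
  braid a b := (Cospan.ofFun finAddFlip).toCorel
  id_comp f := by
    obtain ⟨f, rfl⟩ := ofCospanHom_surjective f
    exact (ofCospanHom_comp (CospanHom.id _) f).symm.trans
      (congrArg ofCospanHom (FinCospan.id_comp f))
  comp_id f := by
    obtain ⟨f, rfl⟩ := ofCospanHom_surjective f
    exact (ofCospanHom_comp f (CospanHom.id _)).symm.trans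
      (congrArg ofCospanHom (FinCospan.comp_id f))
  comp_assoc f g h := by
    obtain ⟨f, rfl⟩ := ofCospanHom_surjective f
    obtain ⟨g, rfl⟩ := ofCospanHom_surjective g
    obtain ⟨h, rfl⟩ := ofCospanHom_surjective h
    simp only [← ofCospanHom_comp]
    exact congrArg ofCospanHom (FinCospan.comp_assoc f g h)
  tens_id a b := (ofCospanHom_tens (CospanHom.id a) (CospanHom.id b)).symm.trans
    (congrArg ofCospanHom (FinCospan.tens_id a b))
  tens_comp f g f' g' := by
    obtain ⟨f, rfl⟩ := ofCospanHom_surjective f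
    obtain ⟨g, rfl⟩ := ofCospanHom_surjective g
    obtain ⟨f', rfl⟩ := ofCospanHom_surjective f'
    obtain ⟨g', rfl⟩ := ofCospanHom_surjective g'
    simp only [← ofCospanHom_comp, ← ofCospanHom_tens]
    exact congrArg ofCospanHom (FinCospan.tens_comp f g f' g')
  tens_assoc f g h := by
    obtain ⟨f, rfl⟩ := ofCospanHom_surjective f
    obtain ⟨g, rfl⟩ := ofCospanHom_surjective g
    obtain ⟨h, rfl⟩ := ofCospanHom_surjective h
    simp only [← ofCospanHom_homCast, ← ofCospanHom_tens]
    exact congrArg ofCospanHom (FinCospan.tens_assoc f g h)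
  id_tens f := by
    obtain ⟨f, rfl⟩ := ofCospanHom_surjective f
    change homCast _ _ (tens (ofCospanHom (CospanHom.id 0)) _) = _
    simp only [← ofCospanHom_homCast, ← ofCospanHom_tens]
    exact congrArg ofCospanHom (FinCospan.id_tens f)
  tens_id_zero f := by
    obtain ⟨f, rfl⟩ := ofCospanHom_surjective f
    change homCast _ _ (tens _ (ofCospanHom (CospanHom.id 0))) = _
    simp only [← ofCospanHom_homCast, ← ofCospanHom_tens]
    exact congrArg ofCospanHom (FinCospan.tens_id_zero f)
  braid_natural {a b c d} f g := by
    obtain ⟨f, rfl⟩ := ofCospanHom_surjective f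
    obtain ⟨g, rfl⟩ := ofCospanHom_surjective g
    change comp _ (ofCospanHom (FinCospan.braid b d)) = comp (ofCospanHom (FinCospan.braid a c)) _
    simp only [← ofCospanHom_tens]
    exact ((ofCospanHom_comp _ _).symm.trans
      (congrArg ofCospanHom (FinCospan.braid_natural f g))).trans
        (ofCospanHom_comp (FinCospan.braid a c) (FinCospan.tens g f))
  hexagon a b c := by
    have h := congrArg ofCospanHom (FinCospan.hexagon a b c)
    refine Eq.trans ?_ (h.trans ?_)
    · exact (ofCospanHom_homCast _ _ (FinCospan.braid a (b + c))).symm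
    · refine (ofCospanHom_comp (FinCospan.tens (FinCospan.braid a b) (FinCospan.id c))
        (homCast _ _ (FinCospan.tens (FinCospan.id b) (FinCospan.braid a c)))).trans ?_
      congr 1
      · exact ofCospanHom_tens (FinCospan.braid a b) (FinCospan.id c)
      · exact (ofCospanHom_homCast _ _ _).trans
          (congrArg _ (ofCospanHom_tens (FinCospan.id b) (FinCospan.braid a c)))
  braid_symm a b := (ofCospanHom_comp (FinCospan.braid a b) (FinCospan.braid b a)).symm.trans
    (congrArg ofCospanHom (FinCospan.braid_symm a b))

/-- The morphism of props `H` that restricts the apex of a cospan to the joint image of its legs. -/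
def H : PROP.Mor FinCospan FinCorel where
  map := Corel.ofCospanHom
  map_id _ := rfl
  map_comp := Corel.ofCospanHom_comp
  map_tens := Corel.ofCospanHom_tens
  map_braid _ _ := rfl

/-! ### The props of circuits -/

/-- An `L`-circuit from `m` to `n`: a cospan of finite sets `i : m → N ← n : o` together with a
finite set `E` of edges, source and target maps `s t : E → N` and a labelling `ℓ : E → L`. -/
structure LCircuit (L : Type u) (m n : ℕ) extends Cospan m n where
  E : Type
  [finE : Finite E]
  s : E → N
  t : E → N
  ℓ : E → L

attribute [instance] LCircuit.finE

namespace LCircuit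

variable {L : Type u}

/-- Isomorphism of `L`-circuits. -/
instance isoSetoid (L : Type u) (m n : ℕ) : Setoid (LCircuit L m n) where
  r f g := ∃ (e : f.N ≃ g.N) (e' : f.E ≃ g.E), (∀ x, e (f.i x) = g.i x) ∧
    (∀ y, e (f.o y) = g.o y) ∧ (∀ a, e (f.s a) = g.s (e' a)) ∧ (∀ a, e (f.t a) = g.t (e' a)) ∧
    ∀ a, f.ℓ a = g.ℓ (e' a)
  iseqv :=
    { refl := fun f => ⟨Equiv.refl _, Equiv.refl _, fun _ => rfl, fun _ => rfl, fun _ => rfl,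
        fun _ => rfl, fun _ => rfl⟩
      symm := by
        rintro f g ⟨e, e', h₁, h₂, h₃, h₄, h₅⟩
        refine ⟨e.symm, e'.symm, fun x => ?_, fun x => ?_, fun x => ?_, fun x => ?_, fun x => ?_⟩
        · rw [← h₁, e.symm_apply_apply]
        · rw [← h₂, e.symm_apply_apply]
        · rw [e.symm_apply_eq, h₃, e'.apply_symm_apply]
        · rw [e.symm_apply_eq, h₄, e'.apply_symm_apply]
        · rw [h₅, e'.apply_symm_apply]
      trans := by
        rintro f g k ⟨e, e', h₁, h₂, h₃, h₄, h₅⟩ ⟨d, d', k₁, k₂, k₃, k₄, k₅⟩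
        exact ⟨e.trans d, e'.trans d', fun x => by simp [h₁, k₁], fun x => by simp [h₂, k₂],
          fun x => by simp [h₃, k₃], fun x => by simp [h₄, k₄], fun x => by simp [h₅, k₅]⟩ }

/-- Composition of `L`-circuits: pushout on nodes, disjoint union on edges. -/
def comp {a b c : ℕ} (f : LCircuit L a b) (g : LCircuit L b c) : LCircuit L a c where
  toCospan := f.toCospan.comp g.toCospan
  E := f.E ⊕ g.E
  s := Sum.elim (fun x => Pushout.inl _ _ (f.s x)) (fun x => Pushout.inr _ _ (g.s x))
  t := Sum.elim (fun x => Pushout.inl _ _ (f.t x)) (fun x => Pushout.inr _ _ (g.t x))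
  ℓ := Sum.elim f.ℓ g.ℓ

/-- Disjoint union of `L`-circuits. -/
def tens {a b c d : ℕ} (f : LCircuit L a b) (g : LCircuit L c d) :
    LCircuit L (a + c) (b + d) where
  toCospan := f.toCospan.tens g.toCospan
  E := f.E ⊕ g.E
  s := Sum.map f.s g.s
  t := Sum.map f.t g.t
  ℓ := Sum.elim f.ℓ g.ℓ

/-- A cospan, seen as an `L`-circuit without edges. -/
def ofCospan {m n : ℕ} (f : Cospan m n) : LCircuit L m n where
  toCospan := f
  E := Empty
  s := Empty.elim
  t := Empty.elim
  ℓ := Empty.elim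

/-- The `L`-circuit with one input, one output and a single edge, labelled `l`, from the input
node to the output node. -/
def edge (l : L) : LCircuit L 1 1 where
  N := Fin 2
  i _ := 0
  o _ := 1
  E := Unit
  s _ := 0
  t _ := 1
  ℓ _ := l

/-- Change of labels along a function. -/
def relabel {L' : Type v} (p : L → L') {m n : ℕ} (f : LCircuit L m n) : LCircuit L' m n where
  toCospan := f.toCospan
  E := f.E
  s := f.s
  t := f.t
  ℓ e := p (f.ℓ e)

/-- The set of connected components of the underlying graph. -/
def Components {m n : ℕ} (f : LCircuit L m n) : Type :=
  Quot (fun p q : f.N => ∃ e, p = f.s e ∧ q = f.t e)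

/-- The underlying cospan of connected components. -/
def components {m n : ℕ} (f : LCircuit L m n) : Cospan m n where
  N := f.Components
  fin := inferInstanceAs (Finite (Quot _))
  i x := Quot.mk _ (f.i x)
  o y := Quot.mk _ (f.o y)

/-- Transport of a circuit along equalities of objects. -/
def reindex {a a' b b' : ℕ} (ha : a = a') (hb : b = b') (f : LCircuit L a b) :
    LCircuit L a' b' where
  toCospan := f.toCospan.reindex ha hb
  E := f.E
  s := f.s
  t := f.t
  ℓ := f.ℓ

theorem comp_congr {a b c : ℕ} {f f' : LCircuit L a b} {g g' : LCircuit L b c} (hf : f ≈ f')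
    (hg : g ≈ g') : f.comp g ≈ f'.comp g' := by
  obtain ⟨e, e', h₁, h₂, h₃, h₄, h₅⟩ := hf
  obtain ⟨d, d', k₁, k₂, k₃, k₄, k₅⟩ := hg
  refine ⟨Pushout.congr e d h₂ k₁, Equiv.sumCongr e' d',
    fun x => congrArg (Pushout.inl _ _) (h₁ x), fun x => congrArg (Pushout.inr _ _) (k₂ x),
    ?_, ?_, ?_⟩ <;> rintro (x | x)
  · exact congrArg (Pushout.inl _ _) (h₃ x)
  · exact congrArg (Pushout.inr _ _) (k₃ x)
  · exact congrArg (Pushout.inl _ _) (h₄ x)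
  · exact congrArg (Pushout.inr _ _) (k₄ x)
  · exact h₅ x
  · exact k₅ x

theorem tens_congr {a b c d : ℕ} {f f' : LCircuit L a b} {g g' : LCircuit L c d} (hf : f ≈ f')
    (hg : g ≈ g') : f.tens g ≈ f'.tens g' := by
  obtain ⟨e, e', h₁, h₂, h₃, h₄, h₅⟩ := hf
  obtain ⟨d, d', k₁, k₂, k₃, k₄, k₅⟩ := hg
  refine ⟨Equiv.sumCongr e d, Equiv.sumCongr e' d',
    fun x => (sum_map_split _ _ _ _ x).trans (by simp only [h₁, k₁]; rfl),
    fun x => (sum_map_split _ _ _ _ x).trans (by simp only [h₂, k₂]; rfl),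
    ?_, ?_, ?_⟩ <;> rintro (x | x)
  · exact congrArg Sum.inl (h₃ x)
  · exact congrArg Sum.inr (k₃ x)
  · exact congrArg Sum.inl (h₄ x)
  · exact congrArg Sum.inr (k₄ x)
  · exact h₅ x
  · exact k₅ x

end LCircuit

/-- Morphisms `m ⟶ n` of `Circ L`: isomorphism classes of `L`-circuits. -/
def CircHom (L : Type u) (m n : ℕ) : Type (max 1 u) := Quotient (LCircuit.isoSetoid L m n)

namespace CircHom

variable {L : Type u}

def mk {m n : ℕ} (f : LCircuit L m n) : CircHom L m n := Quotient.mk _ f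

theorem ind {m n : ℕ} {P : CircHom L m n → Prop} (h : ∀ f, P (mk f)) (f) : P f :=
  Quotient.ind h f

/-- A morphism of `FinCospan`, seen as a morphism of `Circ L` without edges. -/
def ofCospanHom {m n : ℕ} : CospanHom m n → CircHom L m n :=
  Quotient.map LCircuit.ofCospan (by
    rintro f g ⟨e, h, h'⟩
    exact ⟨e, Equiv.refl _, h, h', fun a => a.elim, fun a => a.elim, fun a => a.elim⟩)

def id (n : ℕ) : CircHom L n n := ofCospanHom (CospanHom.id n)

def comp {a b c : ℕ} : CircHom L a b → CircHom L b c → CircHom L a c :=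
  Quotient.map₂ LCircuit.comp (fun _ _ h _ _ h' => LCircuit.comp_congr h h')

def tens {a b c d : ℕ} : CircHom L a b → CircHom L c d → CircHom L (a + c) (b + d) :=
  Quotient.map₂ LCircuit.tens (fun _ _ h _ _ h' => LCircuit.tens_congr h h')

theorem mk_eq {m n : ℕ} {f g : LCircuit L m n} (e : f.N ≃ g.N) (e' : f.E ≃ g.E)
    (h₁ : ∀ x, e (f.i x) = g.i x) (h₂ : ∀ y, e (f.o y) = g.o y)
    (h₃ : ∀ a, e (f.s a) = g.s (e' a)) (h₄ : ∀ a, e (f.t a) = g.t (e' a))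
    (h₅ : ∀ a, f.ℓ a = g.ℓ (e' a)) : mk f = mk g := Quotient.sound ⟨e, e', h₁, h₂, h₃, h₄, h₅⟩

theorem tens_mk {a b c d : ℕ} (f : LCircuit L a b) (g : LCircuit L c d) :
    tens (mk f) (mk g) = mk (f.tens g) := rfl

theorem homCast_mk {a a' b b' : ℕ} (ha : a = a') (hb : b = b') (f : LCircuit L a b) :
    homCast ha hb (mk f) = mk (f.reindex ha hb) := by
  subst ha hb; rfl

theorem ofCospanHom_homCast {a a' b b' : ℕ} (ha : a = a') (hb : b = b') (f : CospanHom a b) :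
    (ofCospanHom (homCast ha hb f) : CircHom L a' b') = homCast ha hb (ofCospanHom f) := by
  subst ha hb; rfl

theorem ofCospanHom_comp {a b c : ℕ} (f : CospanHom a b) (g : CospanHom b c) :
    (ofCospanHom (CospanHom.comp f g) : CircHom L a c)
      = comp (ofCospanHom f) (ofCospanHom g) := by
  induction f using CospanHom.ind with | _ f =>
  induction g using CospanHom.ind with | _ g =>
  exact mk_eq (Equiv.refl _) (Equiv.emptySum Empty Empty).symm (fun _ => rfl) (fun _ => rfl)
    (fun a => a.elim) (fun a => a.elim) (fun a => a.elim)

theorem ofCospanHom_tens {a b c d : ℕ} (f : CospanHom a b) (g : CospanHom c d) :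
    (ofCospanHom (CospanHom.tens f g) : CircHom L (a + c) (b + d))
      = tens (ofCospanHom f) (ofCospanHom g) := by
  induction f using CospanHom.ind with | _ f =>
  induction g using CospanHom.ind with | _ g =>
  exact mk_eq (Equiv.refl _) (Equiv.emptySum Empty Empty).symm (fun _ => rfl) (fun _ => rfl)
    (fun a => a.elim) (fun a => a.elim) (fun a => a.elim)

theorem ofFun_comp {a b c : ℕ} (φ : Fin a → Fin b) (g : LCircuit L b c) :
    comp (ofCospanHom (CospanHom.ofFun φ)) (mk g) = mk { g with i := fun x => g.i (φ x) } :=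
  mk_eq (Pushout.idLeft g.i) (Equiv.emptySum Empty g.E) (fun _ => rfl) (fun _ => rfl)
    (by rintro (a | a); exacts [a.elim, rfl]) (by rintro (a | a); exacts [a.elim, rfl])
    (by rintro (a | a); exacts [a.elim, rfl])

theorem comp_ofFun {a b c : ℕ} (f : LCircuit L a b) (e : Fin b ≃ Fin c) :
    comp (mk f) (ofCospanHom (CospanHom.ofFun e)) = mk { f with o := fun x => f.o (e.symm x) } :=
  mk_eq (Pushout.equivRight f.o e) (Equiv.sumEmpty f.E Empty) (fun _ => rfl) (fun _ => rfl)
    (by rintro (a | a); exacts [rfl, a.elim]) (by rintro (a | a); exacts [rfl, a.elim])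
    (by rintro (a | a); exacts [rfl, a.elim])

end CircHom

open CircHom in
/-- The prop `Circ L` of `L`-circuits. -/
def Circ (L : Type u) : PROP.{max 1 u} where
  Hom := CircHom L
  id := CircHom.id
  comp := comp
  tens := tens
  braid a b := ofCospanHom (FinCospan.braid a b)
  id_comp f := by
    induction f using CircHom.ind with | _ f => exact ofFun_comp _ f
  comp_id f := by
    induction f using CircHom.ind with | _ f => exact comp_ofFun f (Equiv.refl _)
  comp_assoc f g h := by
    induction f using CircHom.ind with | _ f =>
    induction g using CircHom.ind with | _ g =>
    induction h using CircHom.ind with | _ h =>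
    exact mk_eq (Pushout.assoc f.o g.i g.o h.i) (Equiv.sumAssoc _ _ _) (fun _ => rfl)
      (fun _ => rfl) (by rintro ((a | a) | a) <;> rfl) (by rintro ((a | a) | a) <;> rfl)
      (by rintro ((a | a) | a) <;> rfl)
  tens_id a b := (ofCospanHom_tens _ _).symm.trans (congrArg ofCospanHom (FinCospan.tens_id a b))
  tens_comp f g f' g' := by
    induction f using CircHom.ind with | _ f =>
    induction g using CircHom.ind with | _ g =>
    induction f' using CircHom.ind with | _ f' =>
    induction g' using CircHom.ind with | _ g' =>
    refine mk_eq (Pushout.sum f.o g.i f'.o g'.i) (Equiv.sumSumSumComm _ _ _ _)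
      (fun x => ?_) (fun x => ?_)
      (by rintro ((a | a) | (a | a)) <;> rfl) (by rintro ((a | a) | (a | a)) <;> rfl)
      (by rintro ((a | a) | (a | a)) <;> rfl) <;>
      refine Fin.addCases (fun x => ?_) (fun x => ?_) x <;>
      simp [Cospan.tens, Cospan.comp, LCircuit.tens, LCircuit.comp] <;> rfl
  tens_assoc {a b c d a' b'} f g h := by
    induction f using CircHom.ind with | _ f =>
    induction g using CircHom.ind with | _ g =>
    induction h using CircHom.ind with | _ h =>
    simp only [tens_mk, homCast_mk]
    exact mk_eq (Equiv.sumAssoc _ _ _) (Equiv.sumAssoc _ _ _)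
      (fun x => sumAssoc_split _ _ _ x) (fun x => sumAssoc_split _ _ _ x)
      (by rintro ((a | a) | a) <;> rfl) (by rintro ((a | a) | a) <;> rfl)
      (by rintro ((a | a) | a) <;> rfl)
  id_tens {a b} f := by
    induction f using CircHom.ind with | _ f =>
    change homCast _ _ (tens (mk (LCircuit.ofCospan (Cospan.ofFun _root_.id))) (mk f)) = _
    simp only [tens_mk, homCast_mk]
    exact mk_eq (Equiv.emptySum (Fin 0) f.N) (Equiv.emptySum Empty f.E)
      (fun x => emptySum_split (_root_.id : Fin 0 → Fin 0) _ x)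
      (fun x => emptySum_split (_root_.id : Fin 0 → Fin 0) _ x)
      (by rintro (a | a); exacts [a.elim, rfl]) (by rintro (a | a); exacts [a.elim, rfl])
      (by rintro (a | a); exacts [a.elim, rfl])
  tens_id_zero {a b} f := by
    induction f using CircHom.ind with | _ f =>
    change homCast _ _ (tens (mk f) (mk (LCircuit.ofCospan (Cospan.ofFun _root_.id)))) = _
    simp only [tens_mk, homCast_mk]
    exact mk_eq (Equiv.sumEmpty f.N (Fin 0)) (Equiv.sumEmpty f.E Empty)
      (fun x => sumEmpty_split _ (_root_.id : Fin 0 → Fin 0) x)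
      (fun x => sumEmpty_split _ (_root_.id : Fin 0 → Fin 0) x)
      (by rintro (a | a); exacts [rfl, a.elim]) (by rintro (a | a); exacts [rfl, a.elim])
      (by rintro (a | a); exacts [rfl, a.elim])
  braid_natural f g := by
    induction f using CircHom.ind with | _ f =>
    induction g using CircHom.ind with | _ g =>
    rw [tens_mk, tens_mk]
    refine (comp_ofFun _ _).trans (Eq.trans ?_ (ofFun_comp _ _).symm)
    refine mk_eq (Equiv.sumComm _ _) (Equiv.sumComm _ _) (fun x => sumComm_split _ _ x)
      (fun x => ?_) (by rintro (a | a) <;> rfl) (by rintro (a | a) <;> rfl)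
      (by rintro (a | a) <;> rfl)
    refine (sumComm_split _ _ _).trans ?_
    exact congrArg (split g.o f.o) (congrFun (flip_flip _ _) x)
  hexagon a b c := by
    have h := congrArg (ofCospanHom (L := L)) (FinCospan.hexagon a b c)
    refine Eq.trans ?_ (h.trans ?_)
    · exact (ofCospanHom_homCast _ _ (FinCospan.braid a (b + c))).symm
    · refine (ofCospanHom_comp (FinCospan.tens (FinCospan.braid a b) (FinCospan.id c))
        (homCast _ _ (FinCospan.tens (FinCospan.id b) (FinCospan.braid a c)))).trans ?_
      congr 1
      · exact ofCospanHom_tens (FinCospan.braid a b) (FinCospan.id c)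
      · exact (ofCospanHom_homCast _ _ _).trans
          (congrArg _ (ofCospanHom_tens (FinCospan.id b) (FinCospan.braid a c)))
  braid_symm a b := (ofCospanHom_comp (FinCospan.braid a b) (FinCospan.braid b a)).symm.trans
    (congrArg ofCospanHom (FinCospan.braid_symm a b))

namespace Circ

/-- The inclusion of `FinCospan` in `Circ L`. -/
def inclusion (L : Type u) : PROP.Mor FinCospan (Circ L) where
  map := CircHom.ofCospanHom
  map_id _ := rfl
  map_comp := CircHom.ofCospanHom_comp
  map_tens := CircHom.ofCospanHom_tens
  map_braid _ _ := rfl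

/-- The generator `1 ⟶ 1` of `Circ L` given by a label. -/
def edge {L : Type u} (l : L) : (Circ L).Hom 1 1 := CircHom.mk (LCircuit.edge l)

/-- The morphism of props that changes the labels of circuits along a function. -/
def relabel {L : Type u} {L' : Type v} (p : L → L') : PROP.Mor (Circ L) (Circ L') where
  map := Quotient.map (LCircuit.relabel p) (by
    rintro f g ⟨e, e', h₁, h₂, h₃, h₄, h₅⟩
    exact ⟨e, e', h₁, h₂, h₃, h₄, fun a => congrArg p (h₅ a)⟩)
  map_id _ := CircHom.mk_eq (Equiv.refl _) (Equiv.refl _) (fun _ => rfl) (fun _ => rfl)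
    (fun a => a.elim) (fun a => a.elim) (fun a => a.elim)
  map_comp f g := by
    induction f using CircHom.ind with | _ f =>
    induction g using CircHom.ind with | _ g =>
    exact CircHom.mk_eq (Equiv.refl _) (Equiv.refl _) (fun _ => rfl) (fun _ => rfl)
      (fun _ => rfl) (fun _ => rfl) (by rintro (a | a) <;> rfl)
  map_tens f g := by
    induction f using CircHom.ind with | _ f =>
    induction g using CircHom.ind with | _ g =>
    exact CircHom.mk_eq (Equiv.refl _) (Equiv.refl _) (fun _ => rfl) (fun _ => rfl)
      (fun _ => rfl) (fun _ => rfl) (by rintro (a | a) <;> rfl)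
  map_braid _ _ := CircHom.mk_eq (Equiv.refl _) (Equiv.refl _) (fun _ => rfl) (fun _ => rfl)
    (fun a => a.elim) (fun a => a.elim) (fun a => a.elim)

end Circ

namespace LCircuit

variable {L : Type u}

theorem Components.glue {m n : ℕ} (f : LCircuit L m n) (a : f.E) :
    (Quot.mk _ (f.s a) : f.Components) = Quot.mk _ (f.t a) := Quot.sound ⟨a, rfl, rfl⟩

theorem components_congr {m n : ℕ} {f g : LCircuit L m n} (h : f ≈ g) :
    f.components ≈ g.components := by
  obtain ⟨e, e', h₁, h₂, h₃, h₄, h₅⟩ := h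
  refine ⟨⟨Quot.lift (fun x => Quot.mk _ (e x)) ?_, Quot.lift (fun x => Quot.mk _ (e.symm x)) ?_,
    ?_, ?_⟩, fun x => congrArg (Quot.mk _) (h₁ x), fun x => congrArg (Quot.mk _) (h₂ x)⟩
  · rintro _ _ ⟨a, rfl, rfl⟩
    simp only [h₃, h₄]; exact Components.glue g _
  · rintro _ _ ⟨a, rfl, rfl⟩
    obtain ⟨a, rfl⟩ := e'.surjective a
    simp only [← h₃, ← h₄, e.symm_apply_apply]; exact Components.glue f _
  · rintro ⟨x⟩; exact congrArg (Quot.mk _) (e.symm_apply_apply x)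
  · rintro ⟨x⟩; exact congrArg (Quot.mk _) (e.apply_symm_apply x)

theorem components_ofCospan {m n : ℕ} (f : Cospan m n) :
    (ofCospan f : LCircuit L m n).components ≈ f := by
  refine ⟨⟨Quot.lift _root_.id ?_, Quot.mk _, ?_, fun _ => rfl⟩, fun _ => rfl, fun _ => rfl⟩
  · rintro _ _ ⟨a, _⟩; exact a.elim
  · rintro ⟨x⟩; rfl

theorem components_comp {a b c : ℕ} (f : LCircuit L a b) (g : LCircuit L b c) :
    (f.comp g).components ≈ f.components.comp g.components := by
  refine ⟨⟨Quot.lift (Pushout.desc (fun x => Pushout.inl _ _ (Quot.mk _ x))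
      (fun x => Pushout.inr _ _ (Quot.mk _ x)) (fun y => ?_)) ?_,
    Pushout.desc (Quot.lift (fun x => Quot.mk _ (Pushout.inl _ _ x)) ?_)
      (Quot.lift (fun x => Quot.mk _ (Pushout.inr _ _ x)) ?_) (fun y => ?_), ?_, ?_⟩,
    fun _ => rfl, fun _ => rfl⟩
  · exact Pushout.glue (f := f.components.o) (g := g.components.i) y
  · rintro _ _ ⟨a | a, rfl, rfl⟩
    · exact congrArg (Pushout.inl _ _) (Components.glue f a)
    · exact congrArg (Pushout.inr _ _) (Components.glue g a)
  · rintro _ _ ⟨a, rfl, rfl⟩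
    exact Components.glue (f.comp g) (Sum.inl a)
  · rintro _ _ ⟨a, rfl, rfl⟩
    exact Components.glue (f.comp g) (Sum.inr a)
  · exact congrArg (Quot.mk _) (Pushout.glue (f := f.o) (g := g.i) y)
  · rintro ⟨x⟩
    revert x
    exact Pushout.ind (fun _ => rfl) (fun _ => rfl)
  · exact Pushout.ind (by rintro ⟨x⟩; rfl) (by rintro ⟨x⟩; rfl)

theorem components_tens {a b c d : ℕ} (f : LCircuit L a b) (g : LCircuit L c d) :
    (f.tens g).components ≈ f.components.tens g.components := by
  refine ⟨⟨Quot.lift (Sum.map (Quot.mk _) (Quot.mk _)) ?_,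
    Sum.elim (Quot.lift (fun x => Quot.mk _ (Sum.inl x)) ?_)
      (Quot.lift (fun x => Quot.mk _ (Sum.inr x)) ?_), ?_, ?_⟩,
    fun x => sum_map_split _ _ _ _ x, fun x => sum_map_split _ _ _ _ x⟩
  · rintro _ _ ⟨a | a, rfl, rfl⟩
    · exact congrArg Sum.inl (Components.glue f a)
    · exact congrArg Sum.inr (Components.glue g a)
  · rintro _ _ ⟨a, rfl, rfl⟩
    exact Components.glue (f.tens g) (Sum.inl a)
  · rintro _ _ ⟨a, rfl, rfl⟩
    exact Components.glue (f.tens g) (Sum.inr a)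
  · rintro ⟨x | x⟩ <;> rfl
  · rintro (⟨⟨x⟩⟩ | ⟨⟨x⟩⟩) <;> rfl

end LCircuit

/-- The morphism of props that replaces the graph of a circuit by its set of connected
components. -/
def Circ.collapse (L : Type u) : PROP.Mor (Circ L) FinCospan where
  map := Quotient.map LCircuit.components (fun _ _ h => LCircuit.components_congr h)
  map_id _ := Quotient.sound (LCircuit.components_ofCospan _)
  map_comp f g := by
    induction f using CircHom.ind with | _ f =>
    induction g using CircHom.ind with | _ g =>
    exact Quotient.sound (LCircuit.components_comp f g)
  map_tens f g := by
    induction f using CircHom.ind with | _ f =>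
    induction g using CircHom.ind with | _ g =>
    exact Quotient.sound (LCircuit.components_tens f g)
  map_braid _ _ := Quotient.sound (LCircuit.components_ofCospan _)

/-! ### Linear relations and Lagrangian relations -/

section Symplectic

variable {k : Type u} [Field k] {V : Type v} [AddCommGroup V] [Module k V]

/-- A subspace on which the bilinear form `ω` vanishes. -/
def IsIsotropic (ω : LinearMap.BilinForm k V) (L : Submodule k V) : Prop :=
  ∀ x ∈ L, ∀ y ∈ L, ω x y = 0

/-- A Lagrangian subspace: an isotropic subspace that is not properly contained in any other
isotropic subspace. -/
def IsLagrangian (ω : LinearMap.BilinForm k V) (L : Submodule k V) : Prop :=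
  IsIsotropic ω L ∧ ∀ M : Submodule k V, IsIsotropic ω M → L ≤ M → M = L

theorem IsLagrangian.mem_of_orthogonal {ω : LinearMap.BilinForm k V} (hω : ∀ x, ω x x = 0)
    {L : Submodule k V} (hL : IsLagrangian ω L) {x : V} (hx : ∀ y ∈ L, ω x y = 0) : x ∈ L := by
  have hsk : ∀ x y, ω x y = - ω y x := by
    intro x y
    have h := hω (x + y)
    simp only [map_add, LinearMap.add_apply, hω] at h
    linear_combination h
  have h := hL.2 (L ⊔ Submodule.span k {x}) (by
    intro a ha b hb
    obtain ⟨a, ha', _, hs, rfl⟩ := Submodule.mem_sup.1 ha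
    obtain ⟨b, hb', _, ht, rfl⟩ := Submodule.mem_sup.1 hb
    obtain ⟨s, rfl⟩ := Submodule.mem_span_singleton.1 hs
    obtain ⟨t, rfl⟩ := Submodule.mem_span_singleton.1 ht
    have h1 := hL.1 a ha' b hb'
    have h2 := hx b hb'
    have h3 : ω a x = 0 := by rw [hsk, hx a ha', neg_zero]
    simp [h1, h2, h3, hω]) le_sup_left
  rw [← h]
  exact Submodule.mem_sup_right (Submodule.mem_span_singleton_self x)

theorem isLagrangian_of_orthogonal {ω : LinearMap.BilinForm k V} {L : Submodule k V}
    (h : IsIsotropic ω L) (h' : ∀ x, (∀ y ∈ L, ω x y = 0) → x ∈ L) : IsLagrangian ω L :=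
  ⟨h, fun _ hM hLM => le_antisymm (fun x hx => h' x fun y hy => hM x hx y (hLM hy)) hLM⟩

end Symplectic

section Relations

variable (k : Type u) [Field k]

/-- The vector space `(k ⊕ k)ⁿ`, whose elements are families `(φ i, I i)` of potentials and
currents. -/
abbrev Phase (n : ℕ) : Type u := Fin n → k × k

/-- The symplectic structure on `(k ⊕ k)ⁿ`: the direct sum of `n` copies of
`ω ((φ, I), (φ', I')) = φ I' - φ' I`. -/
def symp (n : ℕ) : LinearMap.BilinForm k (Phase k n) :=
  LinearMap.mk₂ k (fun x y => ∑ i, ((x i).1 * (y i).2 - (y i).1 * (x i).2))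
    (fun x x' y => by
      rw [← Finset.sum_add_distrib]
      exact Finset.sum_congr rfl fun i _ => by simp only [Pi.add_apply, Prod.fst_add, Prod.snd_add]; ring)
    (fun c x y => by
      rw [smul_eq_mul, Finset.mul_sum]
      exact Finset.sum_congr rfl fun i _ => by simp only [Pi.smul_apply, Prod.smul_fst, Prod.smul_snd, smul_eq_mul]; ring)
    (fun x y y' => by
      rw [← Finset.sum_add_distrib]
      exact Finset.sum_congr rfl fun i _ => by simp only [Pi.add_apply, Prod.fst_add, Prod.snd_add]; ring)
    (fun c x y => by
      rw [smul_eq_mul, Finset.mul_sum]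
      exact Finset.sum_congr rfl fun i _ => by simp only [Pi.smul_apply, Prod.smul_fst, Prod.smul_snd, smul_eq_mul]; ring)

/-- The symplectic structure `(-ω) ⊕ ω` on `(k ⊕ k)ᵐ ⊕ (k ⊕ k)ⁿ`, the first summand carrying the
conjugate of its symplectic structure. -/
def relSymp (m n : ℕ) : LinearMap.BilinForm k (Phase k m × Phase k n) :=
  -(symp k m).compl₁₂ (LinearMap.fst k _ _) (LinearMap.fst k _ _)
    + (symp k n).compl₁₂ (LinearMap.snd k _ _) (LinearMap.snd k _ _)

variable {k}

theorem symp_apply {n : ℕ} (x y : Phase k n) :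
    symp k n x y = ∑ i, ((x i).1 * (y i).2 - (y i).1 * (x i).2) := rfl

theorem relSymp_apply {m n : ℕ} (x y : Phase k m × Phase k n) :
    relSymp k m n x y = -symp k m x.1 y.1 + symp k n x.2 y.2 := rfl

theorem relSymp_self {m n : ℕ} (x : Phase k m × Phase k n) : relSymp k m n x x = 0 := by
  simp [relSymp_apply, symp_apply]

theorem exists_symp_eq {n : ℕ} (f : Module.Dual k (Phase k n)) : ∃ x, ∀ y, symp k n x y = f y := by
  refine ⟨fun i => (f (Pi.single i (0, 1)), -f (Pi.single i (1, 0))), fun y => ?_⟩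
  have hy : y = ∑ i, ((y i).1 • (Pi.single i (1, 0) : Phase k n)
      + (y i).2 • (Pi.single i (0, 1) : Phase k n)) := by
    conv_lhs => rw [← Finset.univ_sum_single y]
    refine Finset.sum_congr rfl fun i _ => ?_
    rw [← Pi.single_smul, ← Pi.single_smul, ← Pi.single_add]
    congr 1
    ext <;> simp
  conv_rhs => rw [hy]
  rw [map_sum, symp_apply]
  refine Finset.sum_congr rfl fun i _ => ?_
  simp only [map_add, map_smul, smul_eq_mul]
  ring

/-- Linear relations from `(k ⊕ k)ᵐ` to `(k ⊕ k)ⁿ`. -/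
abbrev LinRel (k : Type u) [Field k] (m n : ℕ) : Type u := Submodule k (Phase k m × Phase k n)

namespace LinRel

/-- The usual composition of relations. -/
def comp {a b c : ℕ} (L : LinRel k a b) (L' : LinRel k b c) : LinRel k a c where
  carrier := {p | ∃ y, (p.1, y) ∈ L ∧ (y, p.2) ∈ L'}
  zero_mem' := ⟨0, L.zero_mem, L'.zero_mem⟩
  add_mem' := by
    rintro p q ⟨y, h, h'⟩ ⟨z, l, l'⟩
    exact ⟨y + z, L.add_mem h l, L'.add_mem h' l'⟩
  smul_mem' := by
    rintro r p ⟨y, h, h'⟩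
    exact ⟨r • y, L.smul_mem r h, L'.smul_mem r h'⟩

theorem mem_comp {a b c : ℕ} {L : LinRel k a b} {L' : LinRel k b c} {x : Phase k a}
    {z : Phase k c} : (x, z) ∈ L.comp L' ↔ ∃ y, (x, y) ∈ L ∧ (y, z) ∈ L' := Iff.rfl

/-- The direct sum of linear relations. -/
def tens {a b c d : ℕ} (L : LinRel k a b) (L' : LinRel k c d) : LinRel k (a + c) (b + d) where
  carrier := {p | ((fun i => p.1 (Fin.castAdd c i)), fun i => p.2 (Fin.castAdd d i)) ∈ L ∧
    ((fun i => p.1 (Fin.natAdd a i)), fun i => p.2 (Fin.natAdd b i)) ∈ L'}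
  zero_mem' := ⟨L.zero_mem, L'.zero_mem⟩
  add_mem' h l := ⟨L.add_mem h.1 l.1, L'.add_mem h.2 l.2⟩
  smul_mem' r _ h := ⟨L.smul_mem r h.1, L'.smul_mem r h.2⟩

theorem mem_tens {a b c d : ℕ} {L : LinRel k a b} {L' : LinRel k c d} {x : Phase k (a + c)}
    {y : Phase k (b + d)} : (x, y) ∈ L.tens L' ↔
      ((fun i => x (Fin.castAdd c i)), fun i => y (Fin.castAdd d i)) ∈ L ∧
      ((fun i => x (Fin.natAdd a i)), fun i => y (Fin.natAdd b i)) ∈ L' := Iff.rfl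

/-- The linear relation of pairs `(x, y)` with `x i = y (φ i)` for all `i`. For a bijection `φ`
it is the graph of the corresponding permutation of coordinates. -/
def ofFun {m n : ℕ} (φ : Fin m → Fin n) : LinRel k m n where
  carrier := {p | ∀ i, p.1 i = p.2 (φ i)}
  zero_mem' _ := rfl
  add_mem' h l i := congrArg₂ (· + ·) (h i) (l i)
  smul_mem' r _ h i := congrArg (r • ·) (h i)

theorem mem_ofFun {m n : ℕ} {φ : Fin m → Fin n} {x : Phase k m} {y : Phase k n} :
    (x, y) ∈ (ofFun φ : LinRel k m n) ↔ ∀ i, x i = y (φ i) := Iff.rfl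

theorem ofFun_comp_ofFun {a b c : ℕ} (φ : Fin a → Fin b) (ψ : Fin b → Fin c) :
    (ofFun φ : LinRel k a b).comp (ofFun ψ) = ofFun (ψ ∘ φ) := by
  ext ⟨x, z⟩
  simp only [mem_comp, mem_ofFun]
  constructor
  · rintro ⟨y, h, h'⟩ i
    rw [h, h']; rfl
  · intro h
    exact ⟨fun i => z (ψ i), h, fun _ => rfl⟩

theorem ofFun_tens_ofFun {a b c d : ℕ} (φ : Fin a → Fin b) (ψ : Fin c → Fin d) :
    (ofFun φ : LinRel k a b).tens (ofFun ψ) = ofFun (finSum φ ψ) := by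
  ext ⟨x, z⟩
  simp only [mem_tens, mem_ofFun]
  constructor
  · rintro ⟨h, h'⟩ i
    refine Fin.addCases (fun i => ?_) (fun i => ?_) i
    · rw [finSum_castAdd]; exact h i
    · rw [finSum_natAdd]; exact h' i
  · intro h
    refine ⟨fun i => ?_, fun i => ?_⟩
    · rw [h, finSum_castAdd]
    · rw [h, finSum_natAdd]

theorem mem_homCast {a a' b b' : ℕ} (ha : a = a') (hb : b = b') (L : LinRel k a b)
    (x : Phase k a') (y : Phase k b') :
    (x, y) ∈ (homCast (Hom := LinRel k) ha hb L) ↔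
      ((fun i => x (Fin.cast ha i)), fun i => y (Fin.cast hb i)) ∈ L := by
  subst ha hb; rfl

theorem comp_isLagrangian {a b c : ℕ} {L : LinRel k a b} {L' : LinRel k b c}
    (hL : IsLagrangian (relSymp k a b) L) (hL' : IsLagrangian (relSymp k b c) L') :
    IsLagrangian (relSymp k a c) (L.comp L') := by
  refine isLagrangian_of_orthogonal ?_ ?_
  · rintro ⟨x, z⟩ ⟨y, h, h'⟩ ⟨x₂, z₂⟩ ⟨y₂, h₂, h₂'⟩
    have e := hL.1 _ h _ h₂
    have e' := hL'.1 _ h' _ h₂'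
    simp only [relSymp_apply] at e e' ⊢
    linear_combination e + e'
  · rintro ⟨x, z⟩ hxz
    -- the difference of the two middle components, and a functional vanishing on its kernel
    let T : (L × L') →ₗ[k] Phase k b :=
      (LinearMap.snd k _ _ ∘ₗ L.subtype) ∘ₗ LinearMap.fst k _ _
        - (LinearMap.fst k _ _ ∘ₗ L'.subtype) ∘ₗ LinearMap.snd k _ _
    let g : Module.Dual k (L × L') :=
      ((symp k a x ∘ₗ LinearMap.fst k _ _) ∘ₗ L.subtype) ∘ₗ LinearMap.fst k _ _
        - ((symp k c z ∘ₗ LinearMap.snd k _ _) ∘ₗ L'.subtype) ∘ₗ LinearMap.snd k _ _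
    have hg : g ∈ LinearMap.range T.dualMap := by
      rw [LinearMap.range_dualMap_eq_dualAnnihilator_ker, Submodule.mem_dualAnnihilator]
      rintro ⟨⟨⟨x₁, y₁⟩, h₁⟩, ⟨⟨y₂, z₂⟩, h₂⟩⟩ hT
      have hy : y₁ - y₂ = 0 := hT
      obtain rfl := sub_eq_zero.1 hy
      have := hxz (x₁, z₂) ⟨y₁, h₁, h₂⟩
      rw [relSymp_apply] at this
      change symp k a x x₁ - symp k c z z₂ = 0
      linear_combination -this
    obtain ⟨f, hf⟩ := hg
    obtain ⟨y, hy⟩ := exists_symp_eq f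
    have key : ∀ p ∈ L, ∀ q ∈ L', symp k b y p.2 - symp k b y q.1
        = symp k a x p.1 - symp k c z q.2 := by
      intro p hp q hq
      have := LinearMap.congr_fun hf (⟨p, hp⟩, ⟨q, hq⟩)
      rw [hy, hy, ← map_sub]
      exact this
    refine ⟨y, hL.mem_of_orthogonal relSymp_self fun p hp => ?_,
      hL'.mem_of_orthogonal relSymp_self fun q hq => ?_⟩
    · have := key p hp 0 L'.zero_mem
      simp only [Prod.fst_zero, Prod.snd_zero, map_zero, sub_zero] at this
      rw [relSymp_apply]
      linear_combination this
    · have := key 0 L.zero_mem q hq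
      simp only [Prod.fst_zero, Prod.snd_zero, map_zero, zero_sub] at this
      rw [relSymp_apply]
      linear_combination this

theorem relSymp_add {a b c d : ℕ} (x x' : Phase k (a + c)) (y y' : Phase k (b + d)) :
    relSymp k (a + c) (b + d) (x, y) (x', y')
      = relSymp k a b ((fun i => x (Fin.castAdd c i)), fun i => y (Fin.castAdd d i))
          ((fun i => x' (Fin.castAdd c i)), fun i => y' (Fin.castAdd d i))
        + relSymp k c d ((fun i => x (Fin.natAdd a i)), fun i => y (Fin.natAdd b i))
          ((fun i => x' (Fin.natAdd a i)), fun i => y' (Fin.natAdd b i)) := by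
  simp only [relSymp_apply, symp_apply, Fin.sum_univ_add]
  ring

theorem tens_isLagrangian {a b c d : ℕ} {L : LinRel k a b} {L' : LinRel k c d}
    (hL : IsLagrangian (relSymp k a b) L) (hL' : IsLagrangian (relSymp k c d) L') :
    IsLagrangian (relSymp k (a + c) (b + d)) (L.tens L') := by
  refine isLagrangian_of_orthogonal ?_ ?_
  · rintro ⟨x, y⟩ h ⟨x', y'⟩ h'
    rw [relSymp_add, hL.1 _ h.1 _ h'.1, hL'.1 _ h.2 _ h'.2, add_zero]
  · rintro ⟨x, y⟩ h
    refine ⟨hL.mem_of_orthogonal relSymp_self ?_, hL'.mem_of_orthogonal relSymp_self ?_⟩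
    · rintro ⟨x', y'⟩ hp
      have := h (Fin.addCases x' 0, Fin.addCases y' 0) (by
        rw [mem_tens]
        simp only [Fin.addCases_left, Fin.addCases_right]
        exact ⟨hp, L'.zero_mem⟩)
      rw [relSymp_add] at this
      simp only [Fin.addCases_left, Fin.addCases_right] at this
      rwa [show ((fun _ => (0 : Fin c → k × k) _), fun _ => (0 : Fin d → k × k) _)
        = (0 : Phase k c × Phase k d) from rfl, map_zero, add_zero] at this
    · rintro ⟨x', y'⟩ hp
      have := h (Fin.addCases 0 x', Fin.addCases 0 y') (by
        rw [mem_tens]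
        simp only [Fin.addCases_left, Fin.addCases_right]
        exact ⟨L.zero_mem, hp⟩)
      rw [relSymp_add] at this
      simp only [Fin.addCases_left, Fin.addCases_right] at this
      rwa [show ((fun _ => (0 : Fin a → k × k) _), fun _ => (0 : Fin b → k × k) _)
        = (0 : Phase k a × Phase k b) from rfl, map_zero, zero_add] at this

theorem ofFun_isLagrangian {m n : ℕ} (e : Fin m ≃ Fin n) :
    IsLagrangian (relSymp k m n) (ofFun e) := by
  have hsum : ∀ (x : Phase k m) (y y' : Phase k n),
      relSymp k m n (x, y) ((fun i => y' (e i)), y')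
        = -symp k m x (fun i => y' (e i)) + symp k m (fun i => y (e i)) (fun i => y' (e i)) := by
    intro x y y'
    rw [relSymp_apply]
    congr 1
    simp only [symp_apply]
    exact (Equiv.sum_comp e fun j => (y j).1 * (y' j).2 - (y' j).1 * (y j).2).symm
  refine isLagrangian_of_orthogonal ?_ ?_
  · rintro ⟨x, y⟩ h ⟨x', y'⟩ h'
    obtain rfl : x = fun i => y (e i) := funext h
    obtain rfl : x' = fun i => y' (e i) := funext h'
    rw [hsum]; ring
  · rintro ⟨x, y⟩ h i
    have h' : ∀ w : Phase k m, symp k m (x - fun i => y (e i)) w = 0 := by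
      intro w
      have := (hsum x y fun j => w (e.symm j)).symm.trans
        (h ((fun i => w (e.symm (e i))), fun j => w (e.symm j)) (fun _ => rfl))
      simp only [Equiv.symm_apply_apply] at this
      rw [map_sub, LinearMap.sub_apply]
      linear_combination -this
    have h1 := h' (Pi.single i (0, 1))
    have h2 := h' (Pi.single i (1, 0))
    rw [symp_apply, Finset.sum_eq_single i (fun j _ hj => by simp [hj]) (by simp)] at h1 h2
    simp only [Pi.single_eq_same, Pi.sub_apply, Prod.fst_sub, Prod.snd_sub, mul_one, mul_zero,
      zero_mul, one_mul, sub_zero, zero_sub, neg_eq_zero] at h1 h2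
    exact Prod.ext (sub_eq_zero.1 h1) (sub_eq_zero.1 h2)

end LinRel

/-- Linear Lagrangian relations from `(k ⊕ k)ᵐ` to `(k ⊕ k)ⁿ`: Lagrangian subspaces of
`(k ⊕ k)ᵐ ⊕ (k ⊕ k)ⁿ`, the first summand carrying the conjugate symplectic structure. -/
def LagRelHom (k : Type u) [Field k] (m n : ℕ) : Type u :=
  {L : LinRel k m n // IsLagrangian (relSymp k m n) L}

namespace LagRelHom

def comp {a b c : ℕ} (L : LagRelHom k a b) (L' : LagRelHom k b c) : LagRelHom k a c :=
  ⟨L.1.comp L'.1, LinRel.comp_isLagrangian L.2 L'.2⟩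

def tens {a b c d : ℕ} (L : LagRelHom k a b) (L' : LagRelHom k c d) :
    LagRelHom k (a + c) (b + d) :=
  ⟨L.1.tens L'.1, LinRel.tens_isLagrangian L.2 L'.2⟩

/-- The graph of a permutation of coordinates. -/
def ofEquiv {m n : ℕ} (e : Fin m ≃ Fin n) : LagRelHom k m n :=
  ⟨LinRel.ofFun e, LinRel.ofFun_isLagrangian e⟩

theorem homCast_val {a a' b b' : ℕ} (ha : a = a') (hb : b = b') (L : LagRelHom k a b) :
    (homCast ha hb L).1 = homCast (Hom := LinRel k) ha hb L.1 := by
  subst ha hb; rfl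

end LagRelHom

open LagRelHom in
/-- The prop of linear Lagrangian relations. -/
def LagRel (k : Type u) [Field k] : PROP.{u} where
  Hom := LagRelHom k
  id n := ofEquiv (Equiv.refl _)
  comp := comp
  tens := tens
  braid a b := ofEquiv finAddFlip
  id_comp L := by
    refine Subtype.ext (Submodule.ext ?_)
    rintro ⟨x, z⟩
    constructor
    · rintro ⟨y, h, h'⟩
      obtain rfl : x = y := funext h
      exact h'
    · exact fun h => ⟨x, fun _ => rfl, h⟩
  comp_id L := by
    refine Subtype.ext (Submodule.ext ?_)
    rintro ⟨x, z⟩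
    constructor
    · rintro ⟨y, h, h'⟩
      obtain rfl : y = z := funext h'
      exact h
    · exact fun h => ⟨z, h, fun _ => rfl⟩
  comp_assoc L L' L'' := by
    refine Subtype.ext (Submodule.ext ?_)
    rintro ⟨x, z⟩
    constructor
    · rintro ⟨y, ⟨w, h, h'⟩, h''⟩
      exact ⟨w, h, y, h', h''⟩
    · rintro ⟨w, h, y, h', h''⟩
      exact ⟨y, ⟨w, h, h'⟩, h''⟩
  tens_id a b := Subtype.ext ((LinRel.ofFun_tens_ofFun _ _).trans
    (congrArg LinRel.ofFun (finSum_id a b)))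
  tens_comp {a b c a' b' c'} L M L' M' := by
    refine Subtype.ext (Submodule.ext ?_)
    rintro ⟨x, z⟩
    constructor
    · rintro ⟨⟨y, h₁, h₂⟩, ⟨y', h₁', h₂'⟩⟩
      refine ⟨Fin.addCases y y', LinRel.mem_tens.2 ?_, LinRel.mem_tens.2 ?_⟩ <;>
        simp only [Fin.addCases_left, Fin.addCases_right]
      exacts [⟨h₁, h₁'⟩, ⟨h₂, h₂'⟩]
    · rintro ⟨y, h, h'⟩
      exact ⟨⟨_, h.1, h'.1⟩, ⟨_, h.2, h'.2⟩⟩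
  tens_assoc {a b c d a' b'} L L' L'' := by
    refine Subtype.ext (Submodule.ext ?_)
    rintro ⟨x, z⟩
    rw [homCast_val, LinRel.mem_homCast]
    have e : ∀ {p q r : ℕ} (i : Fin r), Fin.cast (Nat.add_assoc p q r) (Fin.natAdd (p + q) i)
        = Fin.natAdd p (Fin.natAdd q i) := by
      intro p q r i; ext; simp [Nat.add_assoc]
    have e₂ : ∀ {p q r : ℕ} (i : Fin q),
        Fin.cast (Nat.add_assoc p q r) (Fin.castAdd r (Fin.natAdd p i))
          = Fin.natAdd p (Fin.castAdd r i) := fun _ => rfl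
    have e₃ : ∀ {p q r : ℕ} (i : Fin p),
        Fin.cast (Nat.add_assoc p q r) (Fin.castAdd r (Fin.castAdd q i))
          = Fin.castAdd (q + r) i := fun _ => rfl
    simp only [tens, LinRel.mem_tens, e, e₂, e₃, and_assoc]
  id_tens {a b} L := by
    refine Subtype.ext (Submodule.ext ?_)
    rintro ⟨x, z⟩
    rw [homCast_val, LinRel.mem_homCast]
    have e : ∀ {p : ℕ} (i : Fin p), Fin.cast (Nat.zero_add p) (Fin.natAdd 0 i) = i := by
      intro p i; ext; simp
    simp only [tens, LinRel.mem_tens, e]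
    exact ⟨fun h => h.2, fun h => ⟨fun i => i.elim0, h⟩⟩
  tens_id_zero {a b} L := by
    refine Subtype.ext (Submodule.ext ?_)
    rintro ⟨x, z⟩
    rw [homCast_val, LinRel.mem_homCast]
    exact ⟨fun h => h.1, fun h => ⟨h, fun i => i.elim0⟩⟩
  braid_natural {a b c d} L L' := by
    refine Subtype.ext (Submodule.ext ?_)
    rintro ⟨x, z⟩
    constructor
    · rintro ⟨y, ⟨h, h'⟩, hy⟩
      obtain rfl : y = fun i => z (finAddFlip i) := funext hy
      refine ⟨fun i => x (finAddFlip i), fun i => ?_, ?_⟩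
      · exact congrArg x (congrFun (flip_flip a c) i).symm
      · refine LinRel.mem_tens.2 ?_
        simp only [finAddFlip_apply_castAdd, finAddFlip_apply_natAdd] at h h' ⊢
        exact ⟨h', h⟩
    · rintro ⟨y, hy, ⟨h, h'⟩⟩
      obtain rfl : x = fun i => y (finAddFlip i) := funext hy
      refine ⟨fun i => z (finAddFlip i), ?_, fun i => rfl⟩
      refine LinRel.mem_tens.2 ?_
      simp only [finAddFlip_apply_castAdd, finAddFlip_apply_natAdd] at h h' ⊢
      exact ⟨h', h⟩
  hexagon a b c := by
    have hc : ∀ {a a' b b' : ℕ} (ha : a = a') (hb : b = b') (φ : Fin a → Fin b),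
        homCast (Hom := LinRel k) ha hb (LinRel.ofFun φ)
          = LinRel.ofFun (Fin.cast hb ∘ φ ∘ Fin.cast ha.symm) := by
      intro a a' b b' ha hb φ
      subst ha hb; rfl
    refine Subtype.ext ?_
    rw [homCast_val]
    change homCast (Hom := LinRel k) _ _ (LinRel.ofFun _) = LinRel.comp
      (LinRel.tens (LinRel.ofFun _) (LinRel.ofFun _)) (homCast (Hom := LagRelHom k) _ _ _).1
    rw [homCast_val]
    change _ = LinRel.comp _ (homCast (Hom := LinRel k) _ _
      (LinRel.tens (LinRel.ofFun _) (LinRel.ofFun _)))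
    rw [LinRel.ofFun_tens_ofFun, LinRel.ofFun_tens_ofFun, hc, hc, LinRel.ofFun_comp_ofFun]
    exact congrArg LinRel.ofFun (flip_hexagon a b c)
  braid_symm a b := Subtype.ext ((LinRel.ofFun_comp_ofFun _ _).trans
    (congrArg LinRel.ofFun (flip_flip a b)))

end Relations

/-! ### Black-boxing of corelations -/

open Classical in
/-- The linear relation imposed by a corelation `R` between the potentials and currents
`(φ i, I i)` at its inputs and `(φ' j, I' j)` at its outputs: the potential is constant on each
block, and on each block the sum of the input currents equals the sum of the output currents. -/
def Corel.behavior (k : Type u) [Field k] {m n : ℕ} (R : Corel m n) : LinRel k m n where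
  carrier := {p | (∀ s t, R.Rel s t → Sum.elim (fun i => (p.1 i).1) (fun j => (p.2 j).1) s
        = Sum.elim (fun i => (p.1 i).1) (fun j => (p.2 j).1) t) ∧
    ∀ s, ∑ i with R.Rel (Sum.inl i) s, (p.1 i).2 = ∑ j with R.Rel (Sum.inr j) s, (p.2 j).2}
  zero_mem' := ⟨by rintro (i | i) (j | j) _ <;> rfl, fun s => by simp⟩
  add_mem' := by
    rintro p q ⟨h, h'⟩ ⟨l, l'⟩
    refine ⟨fun s t hst => ?_, fun s => ?_⟩
    · have e := congrArg₂ (· + ·) (h s t hst) (l s t hst)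
      rcases s with s | s <;> rcases t with t | t <;> exact e
    · simp only [Prod.fst_add, Prod.snd_add, Pi.add_apply, Finset.sum_add_distrib, h', l']
  smul_mem' := by
    rintro r p ⟨h, h'⟩
    refine ⟨fun s t hst => ?_, fun s => ?_⟩
    · have e := congrArg (r * ·) (h s t hst)
      rcases s with s | s <;> rcases t with t | t <;> exact e
    · simp only [Prod.smul_fst, Prod.smul_snd, Pi.smul_apply, smul_eq_mul, ← Finset.mul_sum, h']

namespace Corel

variable {k : Type u} [Field k]

/-- A family of potentials and currents belongs to the behavior of the corelation of a cospan
as soon as the potentials come from potentials on the apex, and Kirchhoff's current law holds in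
the weak sense. -/
theorem mem_behavior_of_cospan {m n : ℕ} (f : Cospan m n) {x : Phase k m} {y : Phase k n}
    (h : ∃ ψ : f.N → k, (∀ i, (x i).1 = ψ (f.i i)) ∧ ∀ j, (y j).1 = ψ (f.o j))
    (h' : ∀ χ : f.N → k, ∑ i, χ (f.i i) * (x i).2 = ∑ j, χ (f.o j) * (y j).2) :
    (x, y) ∈ f.toCorel.behavior k := by
  classical
  obtain ⟨ψ, hx, hy⟩ := h
  refine ⟨fun s t hst => ?_, fun s => ?_⟩
  · have e : ∀ s, Sum.elim (fun i => (x i).1) (fun j => (y j).1) s = ψ (Sum.elim f.i f.o s) := by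
      rintro (s | s)
      exacts [hx s, hy s]
    rw [e, e]
    exact congrArg ψ hst
  · have := h' (fun p => if p = Sum.elim f.i f.o s then 1 else 0)
    simp only [ite_mul, one_mul, zero_mul, ← Finset.sum_filter] at this
    exact (Finset.sum_congr (Finset.filter_congr fun _ _ => Iff.rfl) fun _ _ => rfl).trans
      (this.trans (Finset.sum_congr (Finset.filter_congr fun _ _ => Iff.rfl) fun _ _ => rfl))

/-- Conversely, elements of the behavior satisfy both conditions on the set of blocks. -/
theorem behavior_spec {m n : ℕ} {R : Corel m n} {x : Phase k m} {y : Phase k n}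
    (h : (x, y) ∈ R.behavior k) :
    (∃ ψ : R.toCospan.N → k, (∀ i, (x i).1 = ψ (R.toCospan.i i)) ∧
      ∀ j, (y j).1 = ψ (R.toCospan.o j)) ∧
    ∀ χ : R.toCospan.N → k,
      ∑ i, χ (R.toCospan.i i) * (x i).2 = ∑ j, χ (R.toCospan.o j) * (y j).2 := by
  classical
  obtain ⟨h, h'⟩ := h
  refine ⟨⟨Quotient.lift _ h, fun _ => rfl, fun _ => rfl⟩, fun χ => ?_⟩
  have : Fintype R.toCospan.N := Fintype.ofFinite _
  rw [← Finset.sum_fiberwise Finset.univ R.toCospan.i,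
    ← Finset.sum_fiberwise Finset.univ R.toCospan.o]
  refine Finset.sum_congr rfl fun q _ => ?_
  obtain ⟨s, rfl⟩ := Quotient.exists_rep q
  have e : ∀ i, R.toCospan.i i = Quotient.mk R s ↔ R.Rel (Sum.inl i) s := fun i => Quotient.eq
  have e' : ∀ j, R.toCospan.o j = Quotient.mk R s ↔ R.Rel (Sum.inr j) s := fun j => Quotient.eq
  have l : ∀ i ∈ Finset.univ.filter (fun i => R.toCospan.i i = Quotient.mk R s),
      χ (R.toCospan.i i) * (x i).2 = χ (Quotient.mk R s) * (x i).2 :=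
    fun i hi => by rw [(Finset.mem_filter.1 hi).2]
  have l' : ∀ j ∈ Finset.univ.filter (fun j => R.toCospan.o j = Quotient.mk R s),
      χ (R.toCospan.o j) * (y j).2 = χ (Quotient.mk R s) * (y j).2 :=
    fun j hj => by rw [(Finset.mem_filter.1 hj).2]
  rw [Finset.sum_congr rfl l, Finset.sum_congr rfl l', ← Finset.mul_sum, ← Finset.mul_sum]
  congr 1
  have := h' s
  convert this using 2
  · ext i; simp [e]
  · ext j; simp [e']

theorem behavior_isLagrangian {m n : ℕ} (R : Corel m n) :
    IsLagrangian (relSymp k m n) (R.behavior k) := by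
  classical
  refine isLagrangian_of_orthogonal ?_ ?_
  · rintro ⟨x, y⟩ h ⟨x', y'⟩ h'
    obtain ⟨⟨ψ, hx, hy⟩, hχ⟩ := behavior_spec h
    obtain ⟨⟨ψ', hx', hy'⟩, hχ'⟩ := behavior_spec h'
    have e := hχ ψ'
    have e' := hχ' ψ
    simp only [← hx, ← hy, ← hx', ← hy'] at e e'
    simp only [relSymp_apply, symp_apply, Finset.sum_sub_distrib]
    linear_combination e - e'
  · rintro ⟨x, y⟩ h
    refine ⟨?_, fun s => ?_⟩
    · -- test against a unit current flowing from `s` to `t`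
      intro s t hst
      let c : Fin m ⊕ Fin n → k := fun r => (if r = s then 1 else 0) - (if r = t then 1 else 0)
      have hc : ∀ r, (∑ i with R.Rel (Sum.inl i) r, c (Sum.inl i))
          + ∑ j with R.Rel (Sum.inr j) r, c (Sum.inr j) = 0 := by
        intro r
        rw [Finset.sum_filter, Finset.sum_filter,
          ← Fintype.sum_sum_type (fun p => if R.Rel p r then c p else 0)]
        have hsplit : ∀ p, (if R.Rel p r then c p else 0)
            = (if p = s then (if R.Rel s r then 1 else 0) else 0)
              - (if p = t then (if R.Rel t r then (1 : k) else 0) else 0) := by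
          intro p
          by_cases h1 : p = s <;> by_cases h2 : p = t <;> by_cases h3 : R.Rel p r <;>
            simp_all [c]
        have hrs : R.Rel s r ↔ R.Rel t r :=
          ⟨fun h => Setoid.trans' R (Setoid.symm' R hst) h, fun h => Setoid.trans' R hst h⟩
        rw [Finset.sum_congr rfl fun p _ => hsplit p, Finset.sum_sub_distrib]
        simp [hrs]
      have := h ((fun i => (0, c (Sum.inl i))), fun j => (0, -c (Sum.inr j))) (by
        refine ⟨by rintro (i | i) (j | j) _ <;> rfl, fun r => ?_⟩
        simp only [Finset.sum_neg_distrib]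
        exact eq_neg_of_add_eq_zero_left (by convert hc r))
      simp only [relSymp_apply, symp_apply, zero_mul, sub_zero, mul_neg,
        Finset.sum_neg_distrib] at this
      have e : ∑ p, Sum.elim (fun i => (x i).1) (fun j => (y j).1) p * c p = 0 := by
        rw [Fintype.sum_sum_type]
        simp only [Sum.elim_inl, Sum.elim_inr]
        linear_combination -this
      simp only [c, mul_sub, mul_ite, mul_one, mul_zero, Finset.sum_sub_distrib,
        Finset.sum_ite_eq', Finset.mem_univ, if_true] at e
      exact sub_eq_zero.1 e
    · -- test against the potential that is one on the block of `s` and zero elsewhere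
      have := h ((fun i => (if R.Rel (Sum.inl i) s then 1 else 0, 0)),
          fun j => (if R.Rel (Sum.inr j) s then 1 else 0, 0)) (by
        refine ⟨?_, fun r => by simp⟩
        intro p q hpq
        have hrs : R.Rel p s ↔ R.Rel q s :=
          ⟨fun h => Setoid.trans' R (Setoid.symm' R hpq) h, fun h => Setoid.trans' R hpq h⟩
        have e : ∀ p, Sum.elim (fun i => if R.Rel (Sum.inl i) s then (1 : k) else 0)
            (fun j => if R.Rel (Sum.inr j) s then 1 else 0) p = if R.Rel p s then 1 else 0 := by
          rintro (p | p) <;> rfl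
        refine (e p).trans (Eq.trans ?_ (e q).symm)
        simp only [hrs])
      simp only [relSymp_apply, symp_apply, mul_zero, zero_sub, ite_mul, one_mul, zero_mul,
        Finset.sum_neg_distrib, ← Finset.sum_filter, neg_neg] at this
      have := eq_of_sub_eq_zero ((sub_eq_add_neg _ _).trans this)
      convert this

end Corel

/-- A Lagrangian relation contained in another one is equal to it. -/
theorem LagRelHom.eq_of_le {k : Type u} [Field k] {m n : ℕ} {L L' : LagRelHom k m n}
    (h : L.1 ≤ L'.1) : L = L' :=
  Subtype.ext (L.2.2 _ L'.2.1 h).symm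

open Corel in
/-- The morphism of props `K`, sending a corelation to the Lagrangian relation it imposes between
potentials and currents. Its values on the generators of `FinCorel` are computed in
`K_spider`. -/
def K (k : Type u) [Field k] : PROP.Mor FinCorel (LagRel k) where
  map R := ⟨R.behavior k, R.behavior_isLagrangian⟩
  map_id n := by
    refine (LagRelHom.eq_of_le ?_).symm
    rintro ⟨x, y⟩ h
    obtain rfl : x = y := funext h
    exact mem_behavior_of_cospan _ ⟨fun i => (x i).1, fun _ => rfl, fun _ => rfl⟩ fun _ => rfl
  map_comp R S := by
    refine (LagRelHom.eq_of_le ?_).symm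
    rintro ⟨x, z⟩ ⟨y, h, h'⟩
    obtain ⟨⟨ψ, hx, hy⟩, hχ⟩ := behavior_spec h
    obtain ⟨⟨ψ', hy', hz⟩, hχ'⟩ := behavior_spec h'
    refine mem_behavior_of_cospan _ ⟨Pushout.desc ψ ψ' fun j => ?_, hx, hz⟩ fun χ => ?_
    · rw [← hy, ← hy']
    · refine (hχ fun p => χ (Pushout.inl _ _ p)).trans (Eq.trans ?_
        (hχ' fun p => χ (Pushout.inr _ _ p)))
      exact Finset.sum_congr rfl fun j _ => by rw [Pushout.glue]
  map_tens R S := by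
    refine (LagRelHom.eq_of_le ?_).symm
    rintro ⟨x, y⟩ ⟨h, h'⟩
    obtain ⟨⟨ψ, hx, hy⟩, hχ⟩ := behavior_spec h
    obtain ⟨⟨ψ', hx', hy'⟩, hχ'⟩ := behavior_spec h'
    refine mem_behavior_of_cospan _ ⟨Sum.elim ψ ψ', fun i => ?_, fun j => ?_⟩ fun χ => ?_
    · refine Fin.addCases (fun i => ?_) (fun i => ?_) i
      · simpa [Cospan.tens] using hx i
      · simpa [Cospan.tens] using hx' i
    · refine Fin.addCases (fun i => ?_) (fun i => ?_) j
      · simpa [Cospan.tens] using hy i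
      · simpa [Cospan.tens] using hy' i
    · rw [Fin.sum_univ_add, Fin.sum_univ_add]
      simp only [Cospan.tens, split_castAdd, split_natAdd]
      exact congrArg₂ (· + ·) (hχ fun p => χ (Sum.inl p)) (hχ' fun p => χ (Sum.inr p))
  map_braid a b := by
    refine (LagRelHom.eq_of_le ?_).symm
    rintro ⟨x, y⟩ h
    refine mem_behavior_of_cospan _ ⟨fun i => (y i).1, fun i => congrArg Prod.fst (h i),
      fun _ => rfl⟩ fun χ => ?_
    have hx : x = fun i => y (finAddFlip i) := funext h
    subst hx
    exact Equiv.sum_comp finAddFlip fun j => χ j * (y j).2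

/-- The cospan with a single node: for `m, n` equal to `2, 1`, `0, 1`, `1, 2` and `1, 0` these are
the multiplication, unit, comultiplication and counit of the Frobenius monoid `1`. -/
def FinCospan.spider (m n : ℕ) : FinCospan.Hom m n :=
  CospanHom.mk { N := Unit, i := fun _ => (), o := fun _ => () }

section Generators

variable {k : Type u} [Field k]

/-- On the spider `m ⟶ n` all potentials are equal and the sum of the input currents equals the sum
of the output currents (there is no condition if there are no terminals). -/
theorem K_spider {m n : ℕ} (x : Phase k m) (y : Phase k n) :
    (x, y) ∈ ((K k).map (H.map (FinCospan.spider m n))).1 ↔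
      (∃ φ, (∀ i, (x i).1 = φ) ∧ ∀ j, (y j).1 = φ) ∧
        (0 < m + n → ∑ i, (x i).2 = ∑ j, (y j).2) := by
  have hR : ∀ s t, Corel.Rel (H.map (FinCospan.spider m n)) s t := by
    rintro (s | s) (t | t) <;> rfl
  constructor
  · rintro ⟨h, h'⟩
    refine ⟨?_, fun hmn => ?_⟩
    · rcases isEmpty_or_nonempty (Fin m ⊕ Fin n) with hE | ⟨⟨s⟩⟩
      · exact ⟨0, fun i => hE.elim (Sum.inl i), fun j => hE.elim (Sum.inr j)⟩
      · exact ⟨_, fun i => h (Sum.inl i) s (hR _ _), fun j => h (Sum.inr j) s (hR _ _)⟩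
    · obtain ⟨s⟩ : Nonempty (Fin m ⊕ Fin n) := ⟨finSumFinEquiv.symm ⟨0, hmn⟩⟩
      have := h' s
      simpa only [hR, Finset.filter_true] using this
  · rintro ⟨⟨φ, hx, hy⟩, h⟩
    refine ⟨?_, fun s => ?_⟩
    · rintro (s | s) (t | t) _ <;> simp [hx, hy]
    · simp only [hR, Finset.filter_true]
      exact h (by rcases s with s | s <;> have := s.pos <;> omega)

end Generators

/-- Black-boxing of circuits made of perfect wire: the composite `K ∘ H ∘ H'`, where `H'` is
`Circ.collapse`. -/
def idealBlackBox (k : Type u) [Field k] : PROP.Mor (Circ Unit) (LagRel k) :=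
  ((Circ.collapse Unit).trans H).trans (K k)

/-- The two properties that define black-boxing of linear circuits: on circuits without edges it is
the composite of `H` and `K`, and a single edge of impedance `Z` is sent to the relation
`φ₂ - φ₁ = Z I₁`, `I₁ = I₂`, where `x 0 = (φ₁, I₁)` and `y 0 = (φ₂, I₂)`. -/
structure IsBlackBoxing {k : Type u} [Field k] (B : PROP.Mor (Circ k) (LagRel k)) : Prop where
  restrict : (Circ.inclusion k).trans B = H.trans (K k)
  impedance : ∀ (Z : k) (x y : Phase k 1), (x, y) ∈ (B.map (Circ.edge Z)).1 ↔
    (y 0).1 - (x 0).1 = Z * (x 0).2 ∧ (x 0).2 = (y 0).2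

end BlackBoxing

/-!
Cutting an edge out of a circuit exposes its two ends as outputs, and gluing a bent edge to them
restores the circuit. Hence `Circ L` is generated by cospans and edges, which gives uniqueness.

For existence, send a circuit to the set of its boundary potentials and currents that extend to
node potentials and edge currents obeying the law of each edge and Kirchhoff's current law. Testing
Kirchhoff's law against the potentials of a second solution shows that this subspace is isotropic
(reciprocity). Since a Lagrangian subspace is a maximal isotropic one, functoriality needs only one
inclusion: the composite, or direct sum, of the behaviors of two circuits is contained in the
behavior of the composite, or disjoint union. By the same principle and induction on generators,
behaviors are Lagrangian.

Nothing here is special to Ohm's law: each label may impose any Lagrangian relation between the two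
ends of an edge. Labels that impose the identity relation behave as ideal wires, because contracting
such an edge to a single node leaves the relation it imposes unchanged.
-/

namespace BlackBoxing

/-! ### Circuits are generated by cospans and edges -/

namespace LCircuit

variable {L : Type u}

/-- The circuit with a single edge labelled `l`, both of whose end nodes are inputs. -/
def bentEdge (l : L) : LCircuit L 2 0 where
  N := Fin 2
  i := id
  o := Fin.elim0
  E := Unit
  s _ := 0
  t _ := 1
  ℓ _ := l

/-- The cospan `2 → 1 ← 0`, which glues two wires together and exposes neither. -/
def cap : Cospan 2 0 where
  N := Unit
  i _ := ()
  o := Fin.elim0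

theorem bentEdge_iso (l : L) :
    bentEdge l ≈ ((edge l).tens (ofCospan (Cospan.ofFun (id : Fin 1 → Fin 1)))).comp
      (ofCospan cap) := by
  let q := split (fun _ : Fin 1 => (1 : Fin 2)) (id : Fin 1 → Fin 1)
  have hq : ∀ y, Sum.elim id (fun _ => 1) (q y) = (1 : Fin 2) :=
    Fin.forall_fin_two.2 ⟨rfl, rfl⟩
  have glued : ∀ y y' : Fin 2, Pushout.inl q cap.i (q y) = Pushout.inl q cap.i (q y') :=
    fun y y' => (Pushout.glue y).trans (Pushout.glue y').symm
  let nodes : Pushout q cap.i ≃ Fin 2 :=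
    { toFun := Pushout.desc (Sum.elim id fun _ => 1) (fun _ => 1) hq
      invFun := fun p => Pushout.inl q cap.i (Sum.inl p)
      left_inv := Pushout.ind
        (Sum.rec (fun _ => rfl) fun y => Subsingleton.elim 0 y ▸ glued 0 1) fun _ => Pushout.glue 0
      right_inv := fun _ => rfl }
  let edges : (Unit ⊕ Empty) ⊕ Empty ≃ Unit :=
    (Equiv.sumEmpty _ _).trans (Equiv.sumEmpty _ _)
  refine Setoid.symm ⟨nodes, edges, Fin.forall_fin_two.2 ⟨rfl, rfl⟩, fun y => y.elim0, ?_, ?_, ?_⟩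
  all_goals
    rintro ((_ | a) | a)
    exacts [rfl, a.elim, a.elim]

/-- The circuit obtained from `f` by deleting the edge `e` and exposing its two ends as additional
outputs. -/
def cutEdge {m n : ℕ} (f : LCircuit L m n) (e : f.E) : LCircuit L m (n + 2) where
  N := f.N
  i := f.i
  o := Fin.append f.o ![f.s e, f.t e]
  E := {a // a ≠ e}
  s a := f.s a
  t a := f.t a
  ℓ a := f.ℓ a

theorem iso_cutEdge_comp_bentEdge {m n : ℕ} (f : LCircuit L m n) (e : f.E) :
    f ≈ (f.cutEdge e).comp ((ofCospan (Cospan.ofFun (id : Fin n → Fin n))).tens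
      (bentEdge (f.ℓ e))) := by
  classical
  let nodes : Pushout (f.cutEdge e).o (finSumFinEquiv (m := n) (n := 2)).symm ≃ f.N :=
    Pushout.equivRight _ _
  let edges : {a // a ≠ e} ⊕ Empty ⊕ Unit ≃ f.E :=
    ((Equiv.refl _).sumCongr (Equiv.emptySum _ _)).trans
      ((Equiv.optionEquivSumPUnit _).symm.trans (Equiv.optionSubtypeNe e))
  have exposed : ∀ y, (f.cutEdge e).o (finSumFinEquiv (Sum.inl y)) = f.o y :=
    Fin.append_left _ _
  have ends : ∀ y, (f.cutEdge e).o (finSumFinEquiv (Sum.inr y)) = ![f.s e, f.t e] y :=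
    Fin.append_right _ _
  refine Setoid.symm ⟨nodes, edges, fun _ => rfl, fun y => ?_, ?_, ?_, ?_⟩
  · exact (congrArg (fun z => nodes (Pushout.inr _ _ z)) (split_castAdd _ _ y)).trans (exposed y)
  · rintro (_ | a | _)
    exacts [rfl, a.elim, ends 0]
  · rintro (_ | a | _)
    exacts [rfl, a.elim, ends 1]
  · rintro (_ | a | _)
    exacts [rfl, a.elim, rfl]

theorem ofCospan_iso {m n : ℕ} (f : LCircuit L m n) [IsEmpty f.E] : ofCospan f.toCospan ≈ f :=
  ⟨Equiv.refl _, Equiv.equivOfIsEmpty Empty f.E, fun _ => rfl, fun _ => rfl, fun a => a.elim,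
    fun a => a.elim, fun a => a.elim⟩

/-- An edge can be cut out of a circuit and glued back as a bent edge, so circuits are generated
by cospans and edges. -/
theorem induction {P : ∀ {m n : ℕ}, LCircuit L m n → Prop}
    (iso : ∀ {m n : ℕ} {f g : LCircuit L m n}, f ≈ g → P f → P g)
    (cospan : ∀ {m n : ℕ} (f : Cospan m n), P (ofCospan f))
    (edge : ∀ l, P (edge l))
    (comp : ∀ {a b c : ℕ} {f : LCircuit L a b} {g : LCircuit L b c}, P f → P g → P (f.comp g))
    (tens : ∀ {a b c d : ℕ} {f : LCircuit L a b} {g : LCircuit L c d},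
      P f → P g → P (f.tens g))
    {m n : ℕ} (f : LCircuit L m n) : P f := by
  have bent (l : L) : P (bentEdge l) :=
    iso (Setoid.symm (bentEdge_iso l)) (comp (tens (edge l) (cospan _)) (cospan _))
  induction h : Nat.card f.E generalizing n f with
  | zero =>
    have : IsEmpty f.E := Finite.card_eq_zero_iff.1 h
    exact iso f.ofCospan_iso (cospan _)
  | succ r ih =>
    obtain ⟨e⟩ : Nonempty f.E := Finite.card_pos_iff.1 (h ▸ r.succ_pos)
    have cut : Nat.card (f.cutEdge e).E = r := by
      classical
      have := Nat.card_congr (Equiv.optionSubtypeNe e)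
      rw [Finite.card_option, h] at this
      exact Nat.succ_injective this
    exact iso (Setoid.symm (f.iso_cutEdge_comp_bentEdge e))
      (comp (ih _ cut) (tens (cospan _) (bent _)))

end LCircuit

theorem Circ.mor_ext {L : Type u} {Q : PROP.{v}} {F G : PROP.Mor (Circ L) Q}
    (restrict : (Circ.inclusion L).trans F = (Circ.inclusion L).trans G)
    (edge : ∀ l, F.map (Circ.edge l) = G.map (Circ.edge l)) : F = G := by
  ext m n f
  induction f using CircHom.ind with | _ f =>
  refine LCircuit.induction
    (P := fun {m n} f => F.map (a := m) (b := n) (CircHom.mk f) = G.map (CircHom.mk f))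
    ?_ ?_ edge ?_ ?_ f
  · intro m n f g h hf
    rwa [← show CircHom.mk f = CircHom.mk g from Quotient.sound h]
  · exact fun {m n} f => congrArg (fun T : PROP.Mor FinCospan Q => T.map (a := m) (b := n)
      (CospanHom.mk f)) restrict
  · exact fun hf hg => (F.map_comp _ _).trans ((congrArg₂ Q.comp hf hg).trans
      (G.map_comp _ _).symm)
  · exact fun hf hg => (F.map_tens _ _).trans ((congrArg₂ Q.tens hf hg).trans
      (G.map_tens _ _).symm)

/-! ### The behavior of a circuit -/

theorem finsum_sum_type {A B M : Type*} [Finite A] [Finite B] [AddCommMonoid M] (F : A ⊕ B → M) :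
    ∑ᶠ x, F x = ∑ᶠ a, F (Sum.inl a) + ∑ᶠ b, F (Sum.inr b) := by
  have := Fintype.ofFinite A
  have := Fintype.ofFinite B
  simp only [finsum_eq_sum_of_fintype, Fintype.sum_sum_type]

section Behavior

variable {k : Type u} [Field k] {L : Type v} {ρ : L → LinRel k 1 1}

theorem IsLagrangian.of_le {V : Type*} [AddCommGroup V] [Module k V]
    {ω : LinearMap.BilinForm k V} {M N : Submodule k V} (hM : IsLagrangian ω M)
    (hN : IsIsotropic ω N) (h : M ≤ N) : IsLagrangian ω N := by
  rwa [hM.2 N hN h]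

namespace LCircuit

variable {a b c d m n : ℕ}

/-- The total current that flows into the nodes of a circuit from its edges, weighted by `χ`, if
every edge `e` draws the current `J e` from its source and delivers `J' e` at its target. -/
noncomputable def edgeInflow (f : LCircuit L m n) (J J' : f.E → k) (χ : f.N → k) : k :=
  ∑ᶠ e, (χ (f.t e) * J' e - χ (f.s e) * J e)

theorem edgeInflow_zero (f : LCircuit L m n) (χ : f.N → k) : f.edgeInflow 0 0 χ = 0 := by
  simp [edgeInflow]

theorem edgeInflow_add (f : LCircuit L m n) (J J' I I' : f.E → k) (χ : f.N → k) :
    f.edgeInflow (J + I) (J' + I') χ = f.edgeInflow J J' χ + f.edgeInflow I I' χ := by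
  rw [edgeInflow, edgeInflow, edgeInflow, ← finsum_add_distrib (Set.toFinite _) (Set.toFinite _)]
  exact finsum_congr fun e => by simp only [Pi.add_apply]; ring

theorem edgeInflow_smul (f : LCircuit L m n) (r : k) (J J' : f.E → k) (χ : f.N → k) :
    f.edgeInflow (r • J) (r • J') χ = r * f.edgeInflow J J' χ := by
  rw [edgeInflow, edgeInflow, mul_finsum]
  exact finsum_congr fun e => by simp only [Pi.smul_apply, smul_eq_mul]; ring

theorem edgeInflow_comp (f : LCircuit L a b) (g : LCircuit L b c) (J J' : f.E → k)
    (I I' : g.E → k) (χ : (f.comp g).N → k) :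
    (f.comp g).edgeInflow (Sum.elim J I) (Sum.elim J' I') χ
      = f.edgeInflow J J' (fun p => χ (Pushout.inl f.o g.i p))
        + g.edgeInflow I I' (fun p => χ (Pushout.inr f.o g.i p)) :=
  finsum_sum_type (A := f.E) (B := g.E) _

theorem edgeInflow_tens (f : LCircuit L a b) (g : LCircuit L c d) (J J' : f.E → k)
    (I I' : g.E → k) (χ : (f.tens g).N → k) :
    (f.tens g).edgeInflow (Sum.elim J I) (Sum.elim J' I') χ
      = f.edgeInflow J J' (fun p => χ (Sum.inl p)) + g.edgeInflow I I' (fun p => χ (Sum.inr p)) :=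
  finsum_sum_type (A := f.E) (B := g.E) _

/-- When every edge labelled `l` imposes the relation `ρ l` between its ends, node potentials `ψ`
and edge currents, `J e` leaving the source of `e` and `J' e` arriving at its target, realize the
boundary values `(x, y)`. Kirchhoff's current law is stated in its weak form, tested against
arbitrary functions `χ` on the nodes. -/
structure Realizes (ρ : L → LinRel k 1 1) (f : LCircuit L m n) (ψ : f.N → k) (J J' : f.E → k)
    (x : Phase k m) (y : Phase k n) : Prop where
  input : ∀ i, (x i).1 = ψ (f.i i)
  output : ∀ j, (y j).1 = ψ (f.o j)
  edge : ∀ e, ((fun _ => (ψ (f.s e), J e)), fun _ => (ψ (f.t e), J' e)) ∈ ρ (f.ℓ e)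
  kirchhoff : ∀ χ : f.N → k, ∑ i, χ (f.i i) * (x i).2 + f.edgeInflow J J' χ
    = ∑ j, χ (f.o j) * (y j).2

namespace Realizes

variable {f : LCircuit L m n} {ψ ψ₂ : f.N → k} {J J' J₂ J₂' : f.E → k} {x x₂ : Phase k m}
  {y y₂ : Phase k n}

theorem zero : f.Realizes ρ 0 0 0 0 0 where
  input _ := rfl
  output _ := rfl
  edge e := (ρ (f.ℓ e)).zero_mem
  kirchhoff χ := by simp [edgeInflow_zero]

theorem add (h : f.Realizes ρ ψ J J' x y) (h₂ : f.Realizes ρ ψ₂ J₂ J₂' x₂ y₂) :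
    f.Realizes ρ (ψ + ψ₂) (J + J₂) (J' + J₂') (x + x₂) (y + y₂) where
  input i := congrArg₂ (· + ·) (h.input i) (h₂.input i)
  output j := congrArg₂ (· + ·) (h.output j) (h₂.output j)
  edge e := (ρ (f.ℓ e)).add_mem (h.edge e) (h₂.edge e)
  kirchhoff χ := by
    simp only [edgeInflow_add, Pi.add_apply, Prod.snd_add, mul_add, Finset.sum_add_distrib]
    linear_combination h.kirchhoff χ + h₂.kirchhoff χ

theorem smul (r : k) (h : f.Realizes ρ ψ J J' x y) :
    f.Realizes ρ (r • ψ) (r • J) (r • J') (r • x) (r • y) where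
  input i := congrArg (r * ·) (h.input i)
  output j := congrArg (r * ·) (h.output j)
  edge e := (ρ (f.ℓ e)).smul_mem r (h.edge e)
  kirchhoff χ := by
    simp only [edgeInflow_smul, Pi.smul_apply, Prod.smul_snd, smul_eq_mul, mul_left_comm _ r,
      ← Finset.mul_sum]
    linear_combination r * h.kirchhoff χ

theorem comp {f : LCircuit L a b} {g : LCircuit L b c} {ψ : f.N → k} {ψ₂ : g.N → k}
    {J J' : f.E → k} {J₂ J₂' : g.E → k} {x : Phase k a} {y : Phase k b} {z : Phase k c}
    (h : f.Realizes ρ ψ J J' x y) (h₂ : g.Realizes ρ ψ₂ J₂ J₂' y z) :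
    (f.comp g).Realizes ρ
      (Pushout.desc ψ ψ₂ fun j => (h.output j).symm.trans (h₂.input j))
      (Sum.elim J J₂) (Sum.elim J' J₂') x z where
  input := h.input
  output := h₂.output
  edge := Sum.rec h.edge h₂.edge
  kirchhoff χ := by
    have glued : ∑ j, χ (Pushout.inl f.o g.i (f.o j)) * (y j).2
        = ∑ j, χ (Pushout.inr f.o g.i (g.i j)) * (y j).2 := by
      simp only [Pushout.glue]
    have hf := h.kirchhoff fun p => χ (Pushout.inl f.o g.i p)
    have hg := h₂.kirchhoff fun p => χ (Pushout.inr f.o g.i p)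
    rw [edgeInflow_comp, ← add_assoc]
    exact (congrArg (· + _) (hf.trans glued)).trans hg

theorem tens {f : LCircuit L a b} {g : LCircuit L c d} {ψ : f.N → k} {ψ₂ : g.N → k}
    {J J' : f.E → k} {J₂ J₂' : g.E → k} {x : Phase k (a + c)} {y : Phase k (b + d)}
    (h : f.Realizes ρ ψ J J' (fun i => x (Fin.castAdd c i)) fun j => y (Fin.castAdd d j))
    (h₂ : g.Realizes ρ ψ₂ J₂ J₂' (fun i => x (Fin.natAdd a i)) fun j => y (Fin.natAdd b j)) :
    (f.tens g).Realizes ρ (Sum.elim ψ ψ₂) (Sum.elim J J₂) (Sum.elim J' J₂') x y where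
  input := Fin.addCases (fun i => by simpa [LCircuit.tens, Cospan.tens] using h.input i)
    fun i => by simpa [LCircuit.tens, Cospan.tens] using h₂.input i
  output := Fin.addCases (fun j => by simpa [LCircuit.tens, Cospan.tens] using h.output j)
    fun j => by simpa [LCircuit.tens, Cospan.tens] using h₂.output j
  edge := Sum.rec h.edge h₂.edge
  kirchhoff χ := by
    have hf := h.kirchhoff fun p => χ (Sum.inl p)
    have hg := h₂.kirchhoff fun p => χ (Sum.inr p)
    rw [edgeInflow_tens, Fin.sum_univ_add, Fin.sum_univ_add]
    simp only [LCircuit.tens, Cospan.tens, split_castAdd, split_natAdd]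
    linear_combination hf + hg

/-- Tellegen's theorem: the weak form of Kirchhoff's law, tested against the potentials of a
second realization, turns a boundary pairing into a sum over the edges. -/
theorem sum_output_sub_sum_input (h : f.Realizes ρ ψ J J' x y)
    (h₂ : f.Realizes ρ ψ₂ J₂ J₂' x₂ y₂) :
    ∑ j, (y₂ j).1 * (y j).2 - ∑ i, (x₂ i).1 * (x i).2 = f.edgeInflow J J' ψ₂ := by
  simp only [h₂.input, h₂.output, ← h.kirchhoff ψ₂, add_sub_cancel_left]

theorem edgeInflow_comm (hρ : ∀ l, IsIsotropic (relSymp k 1 1) (ρ l))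
    (h : f.Realizes ρ ψ J J' x y) (h₂ : f.Realizes ρ ψ₂ J₂ J₂' x₂ y₂) :
    f.edgeInflow J J' ψ₂ = f.edgeInflow J₂ J₂' ψ := by
  refine finsum_congr fun e => ?_
  have isotropic := hρ _ _ (h.edge e) _ (h₂.edge e)
  simp only [relSymp_apply, symp_apply, Finset.univ_unique, Finset.sum_singleton] at isotropic
  linear_combination -isotropic

theorem relSymp_eq_zero (hρ : ∀ l, IsIsotropic (relSymp k 1 1) (ρ l))
    (h : f.Realizes ρ ψ J J' x y) (h₂ : f.Realizes ρ ψ₂ J₂ J₂' x₂ y₂) :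
    relSymp k m n (x, y) (x₂, y₂) = 0 := by
  simp only [relSymp_apply, symp_apply, Finset.sum_sub_distrib]
  linear_combination h₂.sum_output_sub_sum_input h - h.sum_output_sub_sum_input h₂
    - edgeInflow_comm hρ h h₂

end Realizes

/-- The linear relation between the boundary values of a circuit whose edges labelled `l` impose
the relation `ρ l` between their ends. -/
def behavior (ρ : L → LinRel k 1 1) (f : LCircuit L m n) : LinRel k m n where
  carrier := {p | ∃ ψ J J', f.Realizes ρ ψ J J' p.1 p.2}
  zero_mem' := ⟨0, 0, 0, Realizes.zero⟩
  add_mem' := fun ⟨_, _, _, h⟩ ⟨_, _, _, h₂⟩ => ⟨_, _, _, h.add h₂⟩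
  smul_mem' := fun r _ ⟨_, _, _, h⟩ => ⟨_, _, _, h.smul r⟩

theorem behavior_le_of_iso {f g : LCircuit L m n} (h : f ≈ g) : f.behavior ρ ≤ g.behavior ρ := by
  obtain ⟨e, e', hi, ho, hs, ht, hℓ⟩ := h
  rintro ⟨x, y⟩ ⟨ψ, J, J', h⟩
  refine ⟨ψ ∘ e.symm, J ∘ e'.symm, J' ∘ e'.symm, fun i => ?_, fun j => ?_,
    e'.surjective.forall.2 fun a => ?_, fun χ => ?_⟩
  · simpa [← hi] using h.input i
  · simpa [← ho] using h.output j
  · simpa [← hs, ← ht, ← hℓ] using h.edge a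
  · rw [edgeInflow, ← finsum_comp_equiv e']
    simpa [edgeInflow, hi, ho, hs, ht] using h.kirchhoff (χ ∘ e)

theorem behavior_congr {f g : LCircuit L m n} (h : f ≈ g) : f.behavior ρ = g.behavior ρ :=
  le_antisymm (behavior_le_of_iso h) (behavior_le_of_iso (Setoid.symm h))

theorem behavior_isIsotropic (hρ : ∀ l, IsIsotropic (relSymp k 1 1) (ρ l))
    (f : LCircuit L m n) : IsIsotropic (relSymp k m n) (f.behavior ρ) :=
  fun _ ⟨_, _, _, h⟩ _ ⟨_, _, _, h₂⟩ => h.relSymp_eq_zero hρ h₂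

theorem comp_behavior_le (f : LCircuit L a b) (g : LCircuit L b c) :
    (f.behavior ρ).comp (g.behavior ρ) ≤ (f.comp g).behavior ρ :=
  fun _ ⟨_, ⟨_, _, _, h⟩, ⟨_, _, _, h₂⟩⟩ => ⟨_, _, _, h.comp h₂⟩

theorem tens_behavior_le (f : LCircuit L a b) (g : LCircuit L c d) :
    (f.behavior ρ).tens (g.behavior ρ) ≤ (f.tens g).behavior ρ :=
  fun _ ⟨⟨_, _, _, h⟩, ⟨_, _, _, h₂⟩⟩ => ⟨_, _, _, h.tens h₂⟩

theorem le_behavior_edge (l : L) : ρ l ≤ (edge l).behavior ρ := by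
  rintro ⟨x, y⟩ h
  refine ⟨![(x 0).1, (y 0).1], fun _ => (x 0).2, fun _ => (y 0).2, Fin.forall_fin_one.2 rfl,
    Fin.forall_fin_one.2 rfl, fun _ => ?_, fun (χ : Fin 2 → k) => ?_⟩
  · have hx : (fun _ => x 0) = x := funext (Fin.forall_fin_one.2 rfl)
    have hy : (fun _ => y 0) = y := funext (Fin.forall_fin_one.2 rfl)
    rw [← hx, ← hy] at h
    exact h
  · have inflow : edgeInflow (edge l) (fun _ => (x 0).2) (fun _ => (y 0).2) χ
        = χ 1 * (y 0).2 - χ 0 * (x 0).2 := finsum_unique (α := Unit) _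
    rw [inflow, Fin.sum_univ_one, Fin.sum_univ_one]
    exact add_sub_cancel (χ 0 * (x 0).2) (χ 1 * (y 0).2)

theorem corel_behavior_le_behavior_ofCospan (f : Cospan m n) :
    f.toCorel.behavior k ≤ (ofCospan f).behavior ρ := by
  rintro ⟨x, y⟩ h
  obtain ⟨⟨ψ, hx, hy⟩, hχ⟩ := Corel.behavior_spec h
  let ψ' : f.N → k := Function.extend (Corel.incl f) ψ 0
  have extends_ψ (q) : ψ q = ψ' (Corel.incl f q) :=
    ((Corel.incl_injective f).extend_apply _ _ _).symm
  refine ⟨ψ', Empty.elim, Empty.elim, fun i => (hx i).trans (extends_ψ _),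
    fun j => (hy j).trans (extends_ψ _), fun e => e.elim, fun χ => ?_⟩
  have no_edges : edgeInflow (ofCospan f : LCircuit L m n) Empty.elim Empty.elim χ = 0 :=
    finsum_of_isEmpty (α := Empty) _
  rw [no_edges, add_zero]
  exact hχ (χ ∘ Corel.incl f)

theorem behavior_isLagrangian (hρ : ∀ l, IsLagrangian (relSymp k 1 1) (ρ l))
    (f : LCircuit L m n) : IsLagrangian (relSymp k m n) (f.behavior ρ) := by
  have isotropic {m n : ℕ} (f : LCircuit L m n) : IsIsotropic (relSymp k m n) (f.behavior ρ) :=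
    f.behavior_isIsotropic fun l => (hρ l).1
  induction f using LCircuit.induction with
  | iso h hf => rwa [← behavior_congr h]
  | cospan f =>
    exact f.toCorel.behavior_isLagrangian.of_le (isotropic _)
      (corel_behavior_le_behavior_ofCospan f)
  | edge l => exact (hρ l).of_le (isotropic _) (le_behavior_edge l)
  | comp hf hg => exact (LinRel.comp_isLagrangian hf hg).of_le (isotropic _) (comp_behavior_le _ _)
  | tens hf hg => exact (LinRel.tens_isLagrangian hf hg).of_le (isotropic _) (tens_behavior_le _ _)

end LCircuit

end Behavior

/-! ### Black-boxing -/

section Functor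

variable {k : Type u} [Field k] {L : Type v} {ρ : L → LagRelHom k 1 1}

/-- Black-boxing of circuits whose edges are labelled by components of an arbitrary kind, a
component `l` imposing the Lagrangian relation `ρ l` between its two ends: on circuits without
edges it is the composite of `H` and `K`, and on edges it is `ρ`. -/
structure IsBlackBoxingWith (ρ : L → LagRelHom k 1 1) (B : PROP.Mor (Circ L) (LagRel k)) :
    Prop where
  restrict : (Circ.inclusion L).trans B = H.trans (K k)
  edge : ∀ l, B.map (Circ.edge l) = ρ l

theorem IsBlackBoxingWith.unique {B B' : PROP.Mor (Circ L) (LagRel k)}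
    (hB : IsBlackBoxingWith ρ B) (hB' : IsBlackBoxingWith ρ B') : B = B' :=
  Circ.mor_ext (hB.restrict.trans hB'.restrict.symm) fun l => (hB.edge l).trans (hB'.edge l).symm

namespace CircHom

variable {m n : ℕ}

/-- The Lagrangian relation between the boundary values of a circuit, as a function of its
isomorphism class. -/
def behavior (ρ : L → LagRelHom k 1 1) : CircHom L m n → LagRelHom k m n :=
  Quotient.lift (fun f => ⟨f.behavior fun l => (ρ l).1, f.behavior_isLagrangian fun l => (ρ l).2⟩)
    fun _ _ h => Subtype.ext (LCircuit.behavior_congr h)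

theorem behavior_ofCospanHom (f : CospanHom m n) :
    (ofCospanHom f).behavior ρ = (H.trans (K k)).map (a := m) (b := n) f := by
  induction f using CospanHom.ind with | _ f =>
  exact (LagRelHom.eq_of_le (LCircuit.corel_behavior_le_behavior_ofCospan f)).symm

theorem behavior_edge (l : L) : (mk (LCircuit.edge l)).behavior ρ = ρ l :=
  (LagRelHom.eq_of_le (LCircuit.le_behavior_edge (ρ := fun l => (ρ l).1) l)).symm

theorem behavior_comp {a b c : ℕ} (f : CircHom L a b) (g : CircHom L b c) :
    (f.comp g).behavior ρ = (f.behavior ρ).comp (g.behavior ρ) := by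
  induction f using CircHom.ind with | _ f =>
  induction g using CircHom.ind with | _ g =>
  exact (LagRelHom.eq_of_le (LCircuit.comp_behavior_le f g)).symm

theorem behavior_tens {a b c d : ℕ} (f : CircHom L a b) (g : CircHom L c d) :
    (f.tens g).behavior ρ = (f.behavior ρ).tens (g.behavior ρ) := by
  induction f using CircHom.ind with | _ f =>
  induction g using CircHom.ind with | _ g =>
  exact (LagRelHom.eq_of_le (LCircuit.tens_behavior_le f g)).symm

end CircHom

/-- The morphism of props that sends a circuit to its behavior. -/
def blackBoxWith (ρ : L → LagRelHom k 1 1) : PROP.Mor (Circ L) (LagRel k) where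
  map f := f.behavior ρ
  map_id a := (CircHom.behavior_ofCospanHom _).trans ((H.trans (K k)).map_id a)
  map_comp := CircHom.behavior_comp
  map_tens := CircHom.behavior_tens
  map_braid a b := (CircHom.behavior_ofCospanHom _).trans ((H.trans (K k)).map_braid a b)

theorem isBlackBoxingWith_blackBoxWith (ρ : L → LagRelHom k 1 1) :
    IsBlackBoxingWith ρ (blackBoxWith ρ) where
  restrict := by
    ext m n f
    exact CircHom.behavior_ofCospanHom f
  edge := CircHom.behavior_edge

end Functor

/-! ### Ideal wires -/

namespace Circ

variable {L : Type u} {L' : Type v}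

theorem inclusion_trans_relabel (p : L → L') :
    (inclusion L).trans (relabel p) = inclusion L' := by
  ext m n f
  induction f using CospanHom.ind with | _ f =>
  exact Quotient.sound ⟨Equiv.refl _, Equiv.refl _, fun _ => rfl, fun _ => rfl,
    fun a => a.elim, fun a => a.elim, fun a => a.elim⟩

theorem collapse_inclusion {m n : ℕ} (f : CospanHom m n) :
    (collapse L).map ((inclusion L).map (a := m) (b := n) f) = f := by
  induction f using CospanHom.ind with | _ f =>
  exact Quotient.sound (LCircuit.components_ofCospan f)

theorem collapse_edge (l : L) : (collapse L).map (edge l) = FinCospan.id 1 := by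
  have connected := LCircuit.Components.glue (LCircuit.edge l) ()
  let nodes : (LCircuit.edge l).Components ≃ Fin 1 :=
    { toFun := fun _ => 0
      invFun := fun _ => Quot.mk _ (0 : Fin 2)
      left_inv := Quot.ind (Fin.forall_fin_two.2 ⟨rfl, connected⟩)
      right_inv := fun _ => Subsingleton.elim _ _ }
  exact CospanHom.mk_eq nodes (fun _ => Subsingleton.elim (α := Fin 1) _ _)
    fun _ => Subsingleton.elim (α := Fin 1) _ _

theorem relabel_trans_eq_collapse_trans {Q : PROP.{w}} {B : PROP.Mor (Circ L') Q} {p : L → L'}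
    (h : ∀ l, B.map (edge (p l)) = Q.id 1) :
    (relabel p).trans B = (collapse L).trans ((inclusion L').trans B) := by
  refine mor_ext ?_ fun l => ?_
  · refine (congrArg (PROP.Mor.trans · B) (inclusion_trans_relabel p)).trans ?_
    ext m n f
    exact congrArg ((inclusion L').trans B).map (collapse_inclusion f).symm
  · calc B.map (edge (p l)) = Q.id 1 := h l
      _ = ((inclusion L').trans B).map (FinCospan.id 1) := (PROP.Mor.map_id _ 1).symm
      _ = ((inclusion L').trans B).map ((collapse L).map (edge l)) := by rw [collapse_edge]

end Circ

/-! ### Ohm's law -/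

section Ohm

variable {k : Type u} [Field k]

/-- Ohm's law for a resistor of impedance `Z`, as a linear relation between the potentials and
currents `(φ₁, I₁)` and `(φ₂, I₂)` at its ends: `φ₂ - φ₁ = Z I₁` and `I₁ = I₂`. -/
def LinRel.ohm (Z : k) : LinRel k 1 1 where
  carrier := {p | (p.2 0).1 - (p.1 0).1 = Z * (p.1 0).2 ∧ (p.1 0).2 = (p.2 0).2}
  zero_mem' := by simp
  add_mem' := by
    rintro p q ⟨hp, hp'⟩ ⟨hq, hq'⟩
    exact ⟨by simp only [Prod.fst_add, Prod.snd_add, Pi.add_apply]; linear_combination hp + hq,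
      congrArg₂ (· + ·) hp' hq'⟩
  smul_mem' := by
    rintro r p ⟨hp, hp'⟩
    exact ⟨by simp only [Prod.smul_fst, Prod.smul_snd, Pi.smul_apply, smul_eq_mul]
              linear_combination r * hp, congrArg (r * ·) hp'⟩

theorem LinRel.ohm_isLagrangian (Z : k) : IsLagrangian (relSymp k 1 1) (ohm Z) := by
  refine isLagrangian_of_orthogonal ?_ fun p hp => ?_
  · rintro p ⟨hp, hp'⟩ q ⟨hq, hq'⟩
    simp only [relSymp_apply, symp_apply, Fin.sum_univ_one]
    linear_combination (q.1 0).2 * hp - (p.1 0).2 * hq - (p.2 0).1 * hq' + (q.2 0).1 * hp'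
  · have potential := hp (fun _ => (1, 0), fun _ => (1, 0)) (by simp [ohm])
    have current := hp (fun _ => (0, 1), fun _ => (Z, 1)) (by simp [ohm])
    simp only [relSymp_apply, symp_apply, Fin.sum_univ_one] at potential current
    exact ⟨by linear_combination current - Z * potential, by linear_combination potential⟩

/-- Ohm's law as a Lagrangian relation. -/
def LagRelHom.ohm (Z : k) : LagRelHom k 1 1 :=
  ⟨LinRel.ohm Z, LinRel.ohm_isLagrangian Z⟩

theorem LagRelHom.ohm_zero : (ohm 0 : LagRelHom k 1 1) = (LagRel k).id 1 := by
  refine LagRelHom.eq_of_le fun p ⟨potential, current⟩ => Fin.forall_fin_one.2 ?_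
  exact Prod.ext (show (p.1 0).1 = (p.2 0).1 by linear_combination -potential) current

theorem isBlackBoxing_iff {B : PROP.Mor (Circ k) (LagRel k)} :
    IsBlackBoxing B ↔ IsBlackBoxingWith LagRelHom.ohm B where
  mp h := ⟨h.restrict, fun Z => Subtype.ext <| Submodule.ext fun p => h.impedance Z p.1 p.2⟩
  mpr h := ⟨h.restrict, fun Z x y => by rw [h.edge]; rfl⟩

end Ohm

end BlackBoxing

open BlackBoxing in
theorem mainTheorem4_general {k : Type u} [Field k] {L : Type v} (ρ : L → LagRelHom k 1 1) :
    (∃! B : PROP.Mor (Circ L) (LagRel k), IsBlackBoxingWith ρ B) ∧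
    ∀ B : PROP.Mor (Circ L) (LagRel k), IsBlackBoxingWith ρ B →
      ∀ {L' : Type w} (p : L' → L), (∀ l, ρ (p l) = (LagRel k).id 1) →
        (Circ.relabel p).trans B = ((Circ.collapse L').trans H).trans (K k) := by
  refine ⟨⟨blackBoxWith ρ, isBlackBoxingWith_blackBoxWith ρ, fun B hB =>
    hB.unique (isBlackBoxingWith_blackBoxWith ρ)⟩, fun B hB L' p ideal => ?_⟩
  calc (Circ.relabel p).trans B = (Circ.collapse L').trans ((Circ.inclusion L).trans B) :=
        Circ.relabel_trans_eq_collapse_trans fun l => (hB.edge _).trans (ideal l)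
    _ = ((Circ.collapse L').trans H).trans (K k) := by rw [hB.restrict]; rfl

theorem mainTheorem4 (k : Type u) [Field k] :
    (∃! B : BlackBoxing.PROP.Mor (BlackBoxing.Circ k) (BlackBoxing.LagRel k),
      BlackBoxing.IsBlackBoxing B) ∧
    ∀ B : BlackBoxing.PROP.Mor (BlackBoxing.Circ k) (BlackBoxing.LagRel k),
      BlackBoxing.IsBlackBoxing B →
        (BlackBoxing.Circ.relabel (fun _ : Unit => (0 : k))).trans B
          = BlackBoxing.idealBlackBox k := by
  have general := mainTheorem4_general (BlackBoxing.LagRelHom.ohm (k := k))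
  simp only [BlackBoxing.isBlackBoxing_iff]
  exact ⟨general.1, fun B hB => general.2 B hB _ fun _ => BlackBoxing.LagRelHom.ohm_zero⟩
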